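/- Let $d\ge 1$, $r>0$, let $U:\mathbb R^d\to\mathbb R$ be $C^\infty$ and $1$-periodic (that is, $U(x)=U(z)$ whenever $x-z\in\mathbb Z^d$), and let $\mathbb T^d=(\mathbb R/\mathbb Z)^d$. For $\varepsilon>0$, consider the velocity jump process $Z_t=(X_t,Y_t)$ on $\mathbb T^d\times\mathbb S^{d-1}$ at constant temperature $\varepsilon$, i.e. the piecewise deterministic Markov process with generator $$L f(x,y)= y\cdot\nabla_x f(x,y)+\frac{(y\cdot\nabla U(x))_+}{\varepsilon}\bigl(f(x,y^*)-f(x,y)\bigr)+r\Bigl(\int_{\mathbb S^{d-1}} f(x,z)\,dz-f(x,y)\Bigr),$$ where $dz$ is the uniform probability measure on $\mathbb S^{d-1}$ and $y^*=y-2\bigl(y\cdot\tfrac{\nabla U(x)}{|\nabla U(x)|}\bigr)\tfrac{\nabla U(x)}{|\nabla U(x)|}$. Explicitly: after each jump (and at time $0$), if the current state is $(x,y)$, draw independent standard exponential variables $E_1,E_2$, independent of the past, and set $$T=\inf\Bigl\{t>0:\ \int_0^t \tfrac1\varepsilon\bigl(y\cdot\nabla U(x+sy)\bigr)_+\,ds\ge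 E_1\Bigr\}\in(0,\infty],\qquad S=\tfrac1r E_2 .$$ The process moves along $s\mapsto(x+sy,y)$ until the time $T\wedge S$, at which the velocity becomes $y^*$ (computed at the current position) if $T<S$, and is replaced by an independent uniform point of $\mathbb S^{d-1}$ otherwise. For a probability measure $\mu$ on $\mathbb T^d\times\mathbb S^{d-1}$ let $\mu P_t$ be the law of $Z_t$ when $Z_0\sim\mu$. Let $$\nu_\varepsilon=\frac{e^{-U(x)/\varepsilon}}{\int_{\mathbb T^d}e^{-U(u)/\varepsilon}du}\,dx\times dy,$$ with $dy$ uniform on the sphere, and let $\|\mu_1-\mu_2\|_{TV}=\inf_{Z_1\sim\mu_1,\,Z_2\sim\mu_2}\mathbb P(Z_1\ne Z_2)$. Then there exist $c,\theta>0$, depending only on $d$, $r$ and $U$, such that for all $\varepsilon>0$, all initial laws $\mu$ and all $t\ge0$, $$\|\mu P_t-\nu_\varepsilon\|_{TV}\ \le\ e^{-c\,e^{-\theta/\varepsilon}\,(t-\sqrt d)}\ \|\mu-\nu_\varepsilon\|_{TV}.$$ -/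

import Mathlib

open MeasureTheory ProbabilityTheory
open scoped ENNReal ContDiff

noncomputable section

namespace VelocityJump

/-- Euclidean space `ℝ^d`. -/
abbrev Space (d : ℕ) : Type := EuclideanSpace ℝ (Fin d)

/-- The torus `𝕋^d = (ℝ / ℤ)^d`; its `volume` is the normalized Lebesgue measure `dx`. -/
abbrev Torus (d : ℕ) : Type := Fin d → UnitAddCircle

/-- The unit sphere `𝕊^{d-1}` of `ℝ^d`. -/
abbrev UnitSphere (d : ℕ) : Type := Metric.sphere (0 : Space d) 1

/-- States `(x, y)`: position on the torus and velocity on the unit sphere. -/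
abbrev State (d : ℕ) : Type := Torus d × UnitSphere d

variable {d : ℕ}

/-- `U` is `1`-periodic: `x - z ∈ ℤ^d` implies `U x = U z`. -/
def IsPeriodic (U : Space d → ℝ) : Prop :=
  ∀ x z : Space d, (∀ i, ∃ n : ℤ, x i - z i = n) → U x = U z

/-- The canonical projection `ℝ^d → 𝕋^d`. -/
def toTorus (v : Space d) : Torus d := fun i => ((v i : ℝ) : UnitAddCircle)

/-- The representative of a point of the torus in the fundamental domain `[0, 1)^d`. A periodic
function `g` on `ℝ^d`, seen as a function on the torus, is `x ↦ g (rep x)`. -/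
def rep (x : Torus d) : Space d :=
  WithLp.toLp 2 fun i => (AddCircle.equivIco (1 : ℝ) 0 (x i) : ℝ)

theorem toTorus_rep (x : Torus d) : toTorus (rep x) = x := by
  funext i
  exact (AddCircle.equivIco (1 : ℝ) 0).symm_apply_apply (x i)

/-- The gradient of the (periodic) potential at a point of the torus. -/
def grad (U : Space d → ℝ) (x : Torus d) : Space d := gradient U (rep x)

/-- The uniform probability measure `dy` on the sphere: the normalized surface measure (for `d = 1`
the sphere is `{1, -1}` and both points get mass `1/2`). -/
def uniformSphere (d : ℕ) : Measure (UnitSphere d) :=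
  ((volume : Measure (Space d)).toSphere Set.univ)⁻¹ • (volume : Measure (Space d)).toSphere

instance [NeZero d] : IsProbabilityMeasure (uniformSphere d) := by
  have : NeZero ((volume : Measure (Space d)).toSphere) := ⟨Measure.toSphere_ne_zero _⟩
  exact isProbabilityMeasureSMul

/-- The Gibbs law `ν = Z⁻¹ e^{-U(x)/ε} dx × dy`. -/
def gibbs (U : Space d → ℝ) (ε : ℝ) : Measure (State d) :=
  ((volume : Measure (Torus d)).tilted fun x => -U (rep x) / ε).prod (uniformSphere d)

/-- `y - 2 (y · g/|g|) g/|g|`, the reflection of `y` in the hyperplane orthogonal to `g`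
(the identity for `g = 0`). -/
def reflectVec (g y : Space d) : Space d :=
  y - (2 * inner ℝ y (‖g‖⁻¹ • g)) • (‖g‖⁻¹ • g)

theorem norm_reflectVec (g y : Space d) : ‖reflectVec g y‖ = ‖y‖ := by
  rcases eq_or_ne g 0 with rfl | hg
  · simp [reflectVec]
  · have hn : ‖‖g‖⁻¹ • g‖ = 1 := norm_smul_inv_norm (𝕜 := ℝ) hg
    set n := ‖g‖⁻¹ • g
    have h : ‖reflectVec g y‖ ^ 2 = ‖y‖ ^ 2 := by
      change ‖y - (2 * inner ℝ y n) • n‖ ^ 2 = ‖y‖ ^ 2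
      rw [norm_sub_sq_real, real_inner_smul_right, norm_smul, hn, mul_one, Real.norm_eq_abs,
        sq_abs]
      ring
    exact (sq_eq_sq₀ (norm_nonneg _) (norm_nonneg _)).1 h

/-- The reflected velocity `y^*` at the position `x`. -/
def reflect (U : Space d → ℝ) (x : Torus d) (y : UnitSphere d) : UnitSphere d :=
  ⟨reflectVec (grad U x) y, by
    rw [mem_sphere_zero_iff_norm, norm_reflectVec]
    exact mem_sphere_zero_iff_norm.1 y.2⟩

/-- Free flow: after a time `t` without jump, `(x, y)` has become `(x + t y, y)`. -/
def flow (t : ℝ) (z : State d) : State d := (z.1 + toTorus (t • (z.2 : Space d)), z.2)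

/-- The reflection rate `(y · ∇U(x))_+ / ε`. -/
def rate (U : Space d → ℝ) (ε : ℝ) (z : State d) : ℝ :=
  max (inner ℝ (z.2 : Space d) (grad U z.1)) 0 / ε

/-- The reflection clock
`T = inf {t > 0 : ∫₀ᵗ (y · ∇U(x + s y))_+ / ε ds ≥ e}`, equal to `∞` if it never rings. -/
def reflectTime (U : Space d → ℝ) (ε : ℝ) (z : State d) (e : ℝ) : ℝ≥0∞ :=
  ⨅ (t : ℝ) (_ : 0 < t ∧ e ≤ ∫ s in (0 : ℝ)..t, rate U ε (flow s z)), ENNReal.ofReal t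

/-- The variables used between two jumps: two standard exponential variables `E₁`, `E₂`
and the velocity which is taken if the refreshment clock rings first. -/
abbrev Noise (d : ℕ) : Type := ℝ × ℝ × UnitSphere d

/-- The law of `(E₁, E₂, V)`: independent, exponential of mean `1` twice, uniform on the sphere. -/
def noiseLaw (d : ℕ) : Measure (Noise d) :=
  (expMeasure 1).prod ((expMeasure 1).prod (uniformSphere d))

instance [NeZero d] : IsProbabilityMeasure (noiseLaw d) := by
  have : IsProbabilityMeasure (expMeasure 1) := isProbabilityMeasure_expMeasure one_pos
  unfold noiseLaw
  infer_instance

/-- The waiting time `min T S` before the next jump, where `S = E₂ / r` is the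
refreshment clock. -/
def waitTime (U : Space d → ℝ) (r ε : ℝ) (z : State d) (w : Noise d) : ℝ :=
  (min (reflectTime U ε z w.1) (ENNReal.ofReal (w.2.1 / r))).toReal

open Classical in
/-- The state just after the next jump: free flow until the time `min T S`, then the velocity is
reflected if `T < S`, and replaced by the uniform one otherwise. -/
def afterJump (U : Space d → ℝ) (r ε : ℝ) (z : State d) (w : Noise d) : State d :=
  let x := (flow (waitTime U r ε z w) z).1
  if reflectTime U ε z w.1 < ENNReal.ofReal (w.2.1 / r) then (x, reflect U x z.2) else (x, w.2.2)

/-- The `n`-th jump time `T_n` (with `T_0 = 0`) and the state at that time. -/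
def jumpChain (U : Space d → ℝ) (r ε : ℝ) (z : State d) (w : ℕ → Noise d) : ℕ → ℝ × State d
  | 0 => (0, z)
  | n + 1 =>
    let p := jumpChain U r ε z w n
    (p.1 + waitTime U r ε p.2 (w n), afterJump U r ε p.2 (w n))

/-- The number of jumps up to the time `t`, that is the largest `n` with `T_n ≤ t`
(almost surely there is one). -/
def jumpCount (U : Space d → ℝ) (r ε : ℝ) (z : State d) (w : ℕ → Noise d) (t : ℝ) : ℕ :=
  sSup {n : ℕ | (jumpChain U r ε z w n).1 ≤ t}

/-- The velocity jump process `Z_t = (X_t, Y_t)` started at `z`. -/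
def process (U : Space d → ℝ) (r ε : ℝ) (z : State d) (w : ℕ → Noise d) (t : ℝ) : State d :=
  let p := jumpChain U r ε z w (jumpCount U r ε z w t)
  flow (t - p.1) p.2

/-- The law `μ P_t` of the velocity jump process at time `t` when its initial law is `μ`: the
initial state is drawn from `μ`, independently of the i.i.d. sequence `(E₁, E₂, V)_n`. -/
def law (U : Space d → ℝ) (r ε : ℝ) (μ : Measure (State d)) (t : ℝ) : Measure (State d) :=
  (μ.prod (Measure.infinitePi fun _ : ℕ => noiseLaw d)).map fun q => process U r ε q.1 q.2 t

/-- The total variation distance of probability measures: the infimum of `ℙ(Z₁ ≠ Z₂)` over all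
couplings `(Z₁, Z₂)` of `μ₁` and `μ₂`. -/
def tvDist {α : Type*} [MeasurableSpace α] (μ₁ μ₂ : Measure α) : ℝ≥0∞ :=
  ⨅ (π : Measure (α × α)) (_ : π.map Prod.fst = μ₁ ∧ π.map Prod.snd = μ₂), π {q | q.1 ≠ q.2}

end VelocityJump

end

open MeasureTheory ProbabilityTheory
open scoped ENNReal ContDiff Pointwise

noncomputable section

namespace VelocityJump

variable {d : ℕ}

/-! ### The torus, the gradient and the free flow -/

/-! The proof is a Doeblin argument on time windows of length `√d`. The jump rate is at most `M / ε
+ r`, where `M` bounds `|∇U|`, so a prescribed pattern of two refreshments and no reflection has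
density at least `r² e^{-(M/ε + r)√d}` in its two jump times. On this pattern the position is `x + s
y + s₁ v₁ + (√d - s - s₁) v` with `v₁`, `v` independent and uniform. For fixed `s` and `v`, the pair
`(s₁, v₁)` gives polar coordinates of `u = s₁ v₁`. With `τ = √d - s`, the end point `u + (τ - |u|)
v` is a 2-Lipschitz function of `u` that maps the ball of radius `τ` onto a set covering that ball.
If `s < √d / 2`, the ball contains a fundamental cube of the torus. Hence the law at time `√d`
dominates `δ` times Lebesgue × uniform, with `δ` of order `e^{-M√d/ε}`, whatever the starting point
(`exists_minorization`).

Splitting a coupling into its diagonal and off-diagonal parts turns this into a contraction of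
`tvDist` by `1 - δ ≤ e^{-δ}` (`tvDist_le_mul_tvDist`). Iterating over the complete windows in `[0,
t]` loses at most one window, whence `t - √d`.

The iteration needs the Markov property and the invariance of the Gibbs law. Both are read off an
expansion of the transition operators over the number of jumps (`lintegral_process`), which accounts
for all the mass because bounded rates exclude explosion (`ae_exists_lt_jumpChain`). The Markov
property comes from distributing the jumps between two consecutive time intervals (`dyson_add`).
Invariance comes from reversibility up to a change of sign of the velocity: `lintegral_mul_dyson`
identifies the adjoint of each term with the same term conjugated by `flip`, and applying this to
the constant `1` gives `lintegral_semigroup_gibbs`. -/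

theorem toTorus_add (v w : Space d) : toTorus (v + w) = toTorus v + toTorus w := by
  funext i; simp [toTorus]

theorem toTorus_zero : toTorus (0 : Space d) = 0 := by
  funext i; simp [toTorus]

theorem toTorus_neg (v : Space d) : toTorus (-v) = -toTorus v := by
  funext i; simp [toTorus]

theorem continuous_toTorus : Continuous (toTorus : Space d → Torus d) := by
  refine continuous_pi fun i => ?_
  exact (AddCircle.continuous_mk' 1).comp (by fun_prop)

theorem toTorus_eq_iff {v w : Space d} :
    toTorus v = toTorus w ↔ ∀ i, ∃ n : ℤ, v i - w i = n := by
  refine ⟨fun h i => ?_, fun h => funext fun i => ?_⟩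
  · have hi : ((w i : ℝ) : UnitAddCircle) = (v i : ℝ) := (congrFun h i).symm
    rw [QuotientAddGroup.eq, AddSubgroup.mem_zmultiples_iff] at hi
    obtain ⟨n, hn⟩ := hi
    refine ⟨n, ?_⟩
    simp only [zsmul_eq_mul, mul_one] at hn
    rw [hn]; ring
  · obtain ⟨n, hn⟩ := h i
    change ((v i : ℝ) : UnitAddCircle) = (w i : ℝ)
    refine Eq.symm ?_
    rw [QuotientAddGroup.eq, AddSubgroup.mem_zmultiples_iff]
    refine ⟨n, ?_⟩
    simp only [zsmul_eq_mul, mul_one]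
    rw [← hn]; ring

theorem measurable_rep : Measurable (rep : Torus d → Space d) := by
  have h : Measurable fun x : Torus d => fun i => (AddCircle.equivIco (1 : ℝ) 0 (x i) : ℝ) := by
    refine measurable_pi_lambda _ fun i => ?_
    exact measurable_subtype_coe.comp
      ((AddCircle.measurableEquivIco (1 : ℝ) 0).measurable.comp (measurable_pi_apply i))
  exact (PiLp.volume_preserving_toLp (Fin d)).measurable.comp h

theorem norm_rep_le (x : Torus d) : ‖rep x‖ ≤ Real.sqrt d := by
  rw [EuclideanSpace.norm_eq]
  refine Real.sqrt_le_sqrt ?_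
  have h : ∀ i, ‖rep x i‖ ^ 2 ≤ 1 := fun i => by
    have hi := (AddCircle.equivIco (1 : ℝ) 0 (x i)).2
    have h0 : 0 ≤ rep x i := hi.1
    have h1 : rep x i ≤ 1 := hi.2.le.trans_eq (zero_add 1)
    rw [Real.norm_eq_abs, sq_abs]
    nlinarith
  calc ∑ i, ‖rep x i‖ ^ 2 ≤ ∑ _i : Fin d, (1 : ℝ) := Finset.sum_le_sum fun i _ => h i
    _ = d := by simp

section Potential

variable {U : Space d → ℝ}

theorem IsPeriodic.eq_of_toTorus_eq (hper : IsPeriodic U) {v w : Space d}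
    (h : toTorus v = toTorus w) : U v = U w := hper v w (toTorus_eq_iff.1 h)

theorem IsPeriodic.gradient_eq (hper : IsPeriodic U) {v w : Space d}
    (h : toTorus v = toTorus w) : gradient U v = gradient U w := by
  have hU : (fun x => U (x + (v - w))) = U := by
    funext x
    refine hper.eq_of_toTorus_eq ?_
    rw [toTorus_add, sub_eq_add_neg, toTorus_add, toTorus_neg, h]; simp
  have := fderiv_comp_add_right (𝕜 := ℝ) (f := U) (x := w) (v - w)
  rw [hU, add_sub_cancel] at this
  rw [gradient, gradient, this]

theorem IsPeriodic.apply_rep (hper : IsPeriodic U) (v : Space d) : U (rep (toTorus v)) = U v :=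
  hper.eq_of_toTorus_eq (toTorus_rep _)

theorem IsPeriodic.grad_toTorus (hper : IsPeriodic U) (v : Space d) :
    grad U (toTorus v) = gradient U v := hper.gradient_eq (toTorus_rep _)

theorem continuous_gradient (hU : ContDiff ℝ 1 U) : Continuous (gradient U) :=
  (InnerProductSpace.toDual ℝ (Space d)).symm.continuous.comp (hU.continuous_fderiv one_ne_zero)

theorem measurable_grad (hU : ContDiff ℝ 1 U) : Measurable (grad U) :=
  (continuous_gradient hU).measurable.comp measurable_rep

/-- Only values on the fundamental domain occur, and it lies in a compact ball. This `M` is the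
source of the exponent `θ`. -/
theorem exists_norm_grad_le (hU : ContDiff ℝ 1 U) : ∃ M, 0 < M ∧ ∀ x, ‖grad U x‖ ≤ M := by
  obtain ⟨C, hC⟩ := (isCompact_closedBall (0 : Space d) (Real.sqrt d)).exists_bound_of_continuousOn
    (continuous_gradient hU).continuousOn
  refine ⟨max C 1, by positivity, fun x => (hC _ ?_).trans (le_max_left _ _)⟩
  simpa using norm_rep_le x

theorem exists_abs_rep_le (hU : Continuous U) : ∃ C, ∀ x, |U (rep x)| ≤ C := by
  obtain ⟨C, hC⟩ := (isCompact_closedBall (0 : Space d) (Real.sqrt d)).exists_bound_of_continuousOn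
    hU.continuousOn
  exact ⟨C, fun x => hC _ (by simpa using norm_rep_le x)⟩

theorem continuous_flow : Continuous fun p : ℝ × State d => flow p.1 p.2 := by
  unfold flow
  exact ((continuous_snd.fst).add (continuous_toTorus.comp (by fun_prop))).prodMk
    continuous_snd.snd

theorem measurable_flow : Measurable fun p : ℝ × State d => flow p.1 p.2 :=
  continuous_flow.measurable

theorem measurable_flow_right (t : ℝ) : Measurable (flow t : State d → State d) :=
  measurable_flow.comp (measurable_const.prodMk measurable_id)

theorem measurable_flow_comp {α : Type*} [MeasurableSpace α] {f : α → ℝ} {g : α → State d}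
    (hf : Measurable f) (hg : Measurable g) : Measurable fun a => flow (f a) (g a) :=
  measurable_flow.comp (hf.prodMk hg)

theorem flow_add (s t : ℝ) (z : State d) : flow (s + t) z = flow t (flow s z) := by
  simp [flow, add_smul, toTorus_add, add_assoc]

theorem flow_eq (t : ℝ) (z : State d) :
    flow t z = (toTorus (rep z.1 + t • (z.2 : Space d)), z.2) := by
  rw [toTorus_add, toTorus_rep]; rfl

theorem norm_velocity (y : UnitSphere d) : ‖(y : Space d)‖ = 1 := mem_sphere_zero_iff_norm.1 y.2

/-! ### The reflection rate and its integral along the flow -/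

variable {r ε : ℝ}

theorem rate_nonneg (hε : 0 < ε) (z : State d) : 0 ≤ rate U ε z :=
  div_nonneg (le_max_right _ _) hε.le

theorem rate_le {M : ℝ} (hM : ∀ x, ‖grad U x‖ ≤ M) (hε : 0 < ε) (z : State d) :
    rate U ε z ≤ M / ε := by
  refine div_le_div_of_nonneg_right (max_le ?_ ((norm_nonneg _).trans (hM z.1))) hε.le
  calc _ ≤ ‖(z.2 : Space d)‖ * ‖grad U z.1‖ := real_inner_le_norm _ _
    _ ≤ M := by rw [norm_velocity, one_mul]; exact hM _

theorem measurable_rate (hU : ContDiff ℝ 1 U) : Measurable (rate U ε) := by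
  unfold rate
  have h1 : Measurable fun z : State d => (z.2 : Space d) :=
    measurable_subtype_coe.comp measurable_snd
  have h2 : Measurable fun z : State d => grad U z.1 := (measurable_grad hU).comp measurable_fst
  exact ((h1.inner h2).max measurable_const).div_const _

/-- `rep` is discontinuous along the flow. Periodicity replaces it by the straight line in `ℝ^d`,
along which the rate is continuous. -/
theorem rate_flow (hper : IsPeriodic U) (s : ℝ) (z : State d) :
    rate U ε (flow s z) =
      max (inner ℝ (z.2 : Space d) (gradient U (rep z.1 + s • (z.2 : Space d)))) 0 / ε := by
  rw [flow_eq, rate, hper.grad_toTorus]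

theorem continuous_rate_flow (hU : ContDiff ℝ 1 U) (hper : IsPeriodic U) (z : State d) :
    Continuous fun s => rate U ε (flow s z) := by
  simp_rw [rate_flow hper]
  have := continuous_gradient hU
  fun_prop

/-- The integral of the reflection rate along the free flow. -/
def cumRate (U : Space d → ℝ) (ε : ℝ) (z : State d) (t : ℝ) : ℝ :=
  ∫ s in (0 : ℝ)..t, rate U ε (flow s z)

theorem reflectTime_eq (z : State d) (e : ℝ) : reflectTime U ε z e =
    ⨅ (t : ℝ) (_ : 0 < t ∧ e ≤ cumRate U ε z t), ENNReal.ofReal t := rfl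

theorem cumRate_zero (z : State d) : cumRate U ε z 0 = 0 := by simp [cumRate]

section

variable (hU : ContDiff ℝ 1 U) (hper : IsPeriodic U)
include hU hper

theorem hasDerivAt_cumRate (z : State d) (t : ℝ) :
    HasDerivAt (cumRate U ε z) (rate U ε (flow t z)) t := by
  have h := continuous_rate_flow (ε := ε) hU hper z
  exact intervalIntegral.integral_hasDerivAt_right (h.intervalIntegrable _ _)
    (h.stronglyMeasurableAtFilter _ _) h.continuousAt

theorem continuous_cumRate (z : State d) : Continuous (cumRate U ε z) :=
  continuous_iff_continuousAt.2 fun t => (hasDerivAt_cumRate hU hper z t).continuousAt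

theorem monotone_cumRate (hε : 0 < ε) (z : State d) : Monotone (cumRate U ε z) :=
  monotone_of_hasDerivAt_nonneg (fun t => hasDerivAt_cumRate hU hper z t)
    fun _ => rate_nonneg hε _

theorem cumRate_add (z : State d) (s t : ℝ) :
    cumRate U ε z (s + t) = cumRate U ε z s + cumRate U ε (flow s z) t := by
  have h := continuous_rate_flow (ε := ε) hU hper z
  rw [cumRate, ← intervalIntegral.integral_add_adjacent_intervals (h.intervalIntegrable 0 s)
    (h.intervalIntegrable s (s + t)), cumRate, cumRate]
  congr 1
  simp_rw [← flow_add]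
  rw [intervalIntegral.integral_comp_add_left (fun u => rate U ε (flow u z)) s, add_zero]

theorem cumRate_le {M : ℝ} (hM : ∀ x, ‖grad U x‖ ≤ M) (hε : 0 < ε) (z : State d) {t : ℝ}
    (ht : 0 ≤ t) : cumRate U ε z t ≤ M / ε * t := by
  have h := continuous_rate_flow (ε := ε) hU hper z
  calc cumRate U ε z t ≤ ∫ _s in (0 : ℝ)..t, M / ε :=
        intervalIntegral.integral_mono_on ht (h.intervalIntegrable _ _)
          intervalIntegrable_const fun s _ => rate_le hM hε _
    _ = M / ε * t := by simp; ring

theorem measurable_cumRate : Measurable fun p : State d × ℝ => cumRate U ε p.1 p.2 := by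
  have h : ∀ t, Measurable fun z : State d => cumRate U ε z t := fun t => by
    have hm : Measurable (Function.uncurry fun (z : State d) (s : ℝ) => rate U ε (flow s z)) :=
      (measurable_rate hU).comp (measurable_flow.comp measurable_swap)
    simp only [cumRate, intervalIntegral]
    exact (hm.stronglyMeasurable.integral_prod_right.measurable).sub
      hm.stronglyMeasurable.integral_prod_right.measurable
  exact (measurable_uncurry_of_continuous_of_measurable
    (u := fun t z => cumRate U ε z t) (fun z => continuous_cumRate hU hper z) h).comp
      measurable_swap

end

attribute [irreducible] cumRate

end Potential

/-! ### The exponential law -/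

instance isProbabilityMeasure_expMeasure_one : IsProbabilityMeasure (expMeasure 1) :=
  isProbabilityMeasure_expMeasure one_pos

theorem lintegral_expMeasure_one {f : ℝ → ℝ≥0∞} (hf : Measurable f) :
    ∫⁻ x, f x ∂expMeasure 1 = ∫⁻ x in Set.Ioi 0, ENNReal.ofReal (Real.exp (-x)) * f x := by
  have hm : Measurable (exponentialPDF 1) := (measurable_exponentialPDFReal 1).ennreal_ofReal
  have h : expMeasure 1 = volume.withDensity (exponentialPDF 1) := rfl
  rw [h, lintegral_withDensity_eq_lintegral_mul _ hm hf,
    ← setLIntegral_congr (f := fun x => ENNReal.ofReal (Real.exp (-x)) * f x) Ioi_ae_eq_Ici.symm,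
    ← lintegral_indicator measurableSet_Ici]
  refine lintegral_congr fun x => ?_
  by_cases hx : 0 ≤ x
  · simp [exponentialPDF_eq, hx]
  · simp [exponentialPDF_eq, hx]

theorem lintegral_exp_neg_Ioi (a : ℝ) :
    ∫⁻ x in Set.Ioi a, ENNReal.ofReal (Real.exp (-x)) = ENNReal.ofReal (Real.exp (-a)) := by
  rw [← ofReal_integral_eq_lintegral_ofReal (integrableOn_exp_neg_Ioi a)
    (ae_of_all _ fun x => (Real.exp_pos _).le), integral_exp_neg_Ioi]

theorem expMeasure_one_Ioi {a : ℝ} (ha : 0 ≤ a) :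
    expMeasure 1 (Set.Ioi a) = ENNReal.ofReal (Real.exp (-a)) := by
  rw [← lintegral_indicator_one measurableSet_Ioi,
    lintegral_expMeasure_one (measurable_one.indicator measurableSet_Ioi),
    ← lintegral_exp_neg_Ioi, ← lintegral_indicator measurableSet_Ioi,
    ← lintegral_indicator measurableSet_Ioi]
  refine lintegral_congr fun x => ?_
  by_cases hx : a < x
  · simp [hx, ha.trans_lt hx]
  · simp [hx]

theorem ae_expMeasure_one_pos : ∀ᵐ e ∂expMeasure 1, 0 < e := by
  have h : Set.Ioi (0 : ℝ) ∈ ae (expMeasure 1) := by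
    rw [mem_ae_iff_prob_eq_one measurableSet_Ioi, expMeasure_one_Ioi le_rfl]
    simp
  exact h

instance nullSingletonClass_expMeasure_one : NullSingletonClass (expMeasure 1) :=
  inferInstanceAs (NullSingletonClass (volume.withDensity (exponentialPDF 1)))

/-! ### The reflection clock -/

variable {U : Space d → ℝ} {r ε : ℝ}

section

variable (hU : ContDiff ℝ 1 U) (hper : IsPeriodic U)
include hU hper

/-- The integrated rate is continuous, so the infimum defining the clock is not lost at the limit:
if the level `e` were not reached at time `t`, it would not be reached slightly later either. -/
theorem reflectTime_le_iff (hε : 0 < ε) (z : State d) (e : ℝ) {t : ℝ} (ht : 0 < t) :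
    reflectTime U ε z e ≤ ENNReal.ofReal t ↔ e ≤ cumRate U ε z t := by
  refine ⟨fun h => ?_, fun h => reflectTime_eq z e ▸ iInf₂_le t ⟨ht, h⟩⟩
  by_contra! hlt
  obtain ⟨u, htu, hu⟩ := ((((continuous_cumRate (ε := ε) hU hper z).tendsto t).eventually
    (gt_mem_nhds hlt)).filter_mono nhdsWithin_le_nhds).and
      (self_mem_nhdsWithin (s := Set.Ioi t)) |>.exists
  have h1 : reflectTime U ε z e < ENNReal.ofReal u :=
    h.trans_lt ((ENNReal.ofReal_lt_ofReal_iff (ht.trans hu)).2 hu)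
  simp only [reflectTime_eq, iInf_lt_iff] at h1
  obtain ⟨v, ⟨hv0, hv⟩, hvu⟩ := h1
  have hvu' : v < u := (ENNReal.ofReal_lt_ofReal_iff (ht.trans hu)).1 hvu
  exact absurd (hv.trans (monotone_cumRate hU hper hε z hvu'.le)) (not_le.2 htu)

theorem reflectTime_pos (hε : 0 < ε) (z : State d) {e : ℝ} (he : 0 < e) :
    0 < reflectTime U ε z e := by
  rw [pos_iff_ne_zero]
  intro h
  have h1 : ∀ t, 0 < t → e ≤ cumRate U ε z t := fun t ht =>
    (reflectTime_le_iff hU hper hε z e ht).1 (h ▸ zero_le)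
  have h2 : e ≤ cumRate U ε z 0 :=
    ge_of_tendsto (((continuous_cumRate (ε := ε) hU hper z).tendsto 0).mono_left
      (nhdsWithin_le_nhds (s := Set.Ioi 0))) (by filter_upwards [self_mem_nhdsWithin] with t ht
                                                 exact h1 t ht)
  rw [cumRate_zero] at h2
  exact absurd he (not_lt.2 h2)

theorem measurable_reflectTime (hε : 0 < ε) :
    Measurable fun p : State d × ℝ => reflectTime U ε p.1 p.2 := by
  refine measurable_of_Iio fun a => ?_
  have h : (fun p : State d × ℝ => reflectTime U ε p.1 p.2) ⁻¹' Set.Iio a =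
      -- By monotonicity of the integrated rate, rational times suffice to detect that the clock has
      -- rung.
      ⋃ q : {q : ℚ // (0 : ℝ) < q ∧ ENNReal.ofReal q < a},
        {p | p.2 ≤ cumRate U ε p.1 (q : ℚ)} := by
    ext p
    simp only [Set.mem_preimage, Set.mem_Iio, Set.mem_iUnion, Set.mem_ofPred_eq]
    refine ⟨fun hp => ?_, fun ⟨⟨q, hq0, hqa⟩, hq⟩ => ?_⟩
    · obtain ⟨b, hb1, hb2⟩ := exists_between hp
      have hb : b ≠ ⊤ := (hb2.trans_le le_top).ne
      simp only [reflectTime_eq, iInf_lt_iff] at hb1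
      obtain ⟨v, ⟨hv0, hv⟩, hvb⟩ := hb1
      have hvb' : v < b.toReal := (ENNReal.ofReal_lt_iff_lt_toReal hv0.le hb).1 hvb
      obtain ⟨q, hvq, hqb⟩ := exists_rat_btwn hvb'
      refine ⟨⟨q, hv0.trans hvq, ?_⟩, hv.trans (monotone_cumRate hU hper hε _ hvq.le)⟩
      exact ((ENNReal.ofReal_lt_iff_lt_toReal (hv0.trans hvq).le hb).2 hqb).trans hb2
    · rw [reflectTime_eq]
      exact (iInf₂_le (q : ℝ) ⟨hq0, hq⟩).trans_lt hqa
  rw [h]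
  refine MeasurableSet.iUnion fun q => measurableSet_le measurable_snd ?_
  exact (measurable_cumRate hU hper).comp (measurable_fst.prodMk measurable_const)

theorem expMeasure_lt_reflectTime (hε : 0 < ε) (z : State d) {t : ℝ} (ht : 0 ≤ t) :
    expMeasure 1 {e | ENNReal.ofReal t < reflectTime U ε z e} =
      ENNReal.ofReal (Real.exp (-cumRate U ε z t)) := by
  have h0 : 0 ≤ cumRate U ε z t := by
    simpa [cumRate_zero] using monotone_cumRate hU hper hε z ht
  rw [← expMeasure_one_Ioi h0]
  refine measure_congr ?_
  filter_upwards [ae_expMeasure_one_pos] with e he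
  refine propext ?_
  change ENNReal.ofReal t < reflectTime U ε z e ↔ cumRate U ε z t < e
  rcases ht.eq_or_lt with rfl | ht
  · simpa [cumRate_zero, he] using reflectTime_pos hU hper hε z he
  · rw [← not_le, ← not_le, reflectTime_le_iff hU hper hε z e ht]

/-- The events `T ≥ t` and `T > t` have the same probability although the integrated rate may be
flat: the former forces `e ≥ A(t)`, and the exponential law does not charge the level `A(t)`. -/
theorem expMeasure_le_reflectTime (hε : 0 < ε) (z : State d) {t : ℝ} (ht : 0 < t) :
    expMeasure 1 {e | ENNReal.ofReal t ≤ reflectTime U ε z e} =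
      ENNReal.ofReal (Real.exp (-cumRate U ε z t)) := by
  have h0 : 0 ≤ cumRate U ε z t := by
    simpa [cumRate_zero] using monotone_cumRate hU hper hε z ht.le
  refine le_antisymm ?_ ?_
  · rw [← expMeasure_one_Ioi h0, measure_congr (Ioi_ae_eq_Ici (a := cumRate U ε z t))]
    refine measure_mono ?_
    intro e he
    rw [Set.mem_ofPred_eq] at he
    by_contra hlt
    have hlt : e < cumRate U ε z t := by simpa using hlt
    obtain ⟨u, hu, hu'⟩ := ((((continuous_cumRate (ε := ε) hU hper z).tendsto t).eventually
      (lt_mem_nhds hlt)).filter_mono nhdsWithin_le_nhds).and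
        (Ioo_mem_nhdsLT ht) |>.exists
    have := (reflectTime_le_iff hU hper hε z e hu'.1).2 hu.le
    exact absurd (he.trans this) (not_le.2 ((ENNReal.ofReal_lt_ofReal_iff ht).2 hu'.2))
  · rw [← expMeasure_lt_reflectTime hU hper hε z ht.le]
    refine measure_mono ?_
    intro e he
    rw [Set.mem_ofPred_eq] at he ⊢
    exact he.le

theorem lintegral_rate_mul_exp_neg (hε : 0 < ε) (z : State d) {t : ℝ} (ht : 0 ≤ t) :
    ∫⁻ s in Set.Ioc 0 t, ENNReal.ofReal (rate U ε (flow s z) * Real.exp (-cumRate U ε z s)) =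
      1 - ENNReal.ofReal (Real.exp (-cumRate U ε z t)) := by
  have hc : Continuous fun s => rate U ε (flow s z) * Real.exp (-cumRate U ε z s) :=
    (continuous_rate_flow hU hper z).mul (continuous_cumRate hU hper z).neg.rexp
  have hF : ∀ s, HasDerivAt (fun s => -Real.exp (-cumRate U ε z s))
      (rate U ε (flow s z) * Real.exp (-cumRate U ε z s)) s := fun s => by
    have := ((hasDerivAt_cumRate (ε := ε) hU hper z s).neg.exp).neg
    rw [mul_comm, ← neg_neg (Real.exp _ * _), ← mul_neg]
    exact this
  rw [← ofReal_integral_eq_lintegral_ofReal (hc.integrableOn_Ioc)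
    (ae_of_all _ fun s => mul_nonneg (rate_nonneg hε _) (Real.exp_pos _).le),
    ← intervalIntegral.integral_of_le ht,
    intervalIntegral.integral_eq_sub_of_hasDerivAt (fun s _ => hF s) (hc.intervalIntegrable _ _),
    cumRate_zero, ← ENNReal.ofReal_one, ← ENNReal.ofReal_sub _ (Real.exp_pos _).le]
  congr 1
  simp
  ring

/-- The law of the reflection clock has the density `a e^{-A}` on `(0, ∞)`, where `a` is the
reflection rate along the flow and `A` its integral. -/
theorem lintegral_reflectTime (hε : 0 < ε) (z : State d) {H : ℝ → ℝ≥0∞} (hH : Measurable H) :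
    ∫⁻ e in {e | reflectTime U ε z e < ⊤}, H (reflectTime U ε z e).toReal ∂expMeasure 1 =
      ∫⁻ s in Set.Ioi 0,
        ENNReal.ofReal (rate U ε (flow s z) * Real.exp (-cumRate U ε z s)) * H s := by
  have hT : Measurable (reflectTime U ε z) :=
    (measurable_reflectTime hU hper hε).comp measurable_prodMk_left
  have hc : Measurable fun s => ENNReal.ofReal (rate U ε (flow s z) *
      Real.exp (-cumRate U ε z s)) :=
    ((continuous_rate_flow hU hper z).mul
      (continuous_cumRate hU hper z).neg.rexp).measurable.ennreal_ofReal
  have hS : MeasurableSet {e | reflectTime U ε z e < ⊤} := hT measurableSet_Iio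
  -- The two finite measures are compared on half-lines, where the right-hand side is `1 -
  -- e^{-A(t)}` by `lintegral_rate_mul_exp_neg`.
  suffices h : ((expMeasure 1).restrict {e | reflectTime U ε z e < ⊤}).map
      (fun e => (reflectTime U ε z e).toReal) = (volume.restrict (Set.Ioi 0)).withDensity
        fun s => ENNReal.ofReal (rate U ε (flow s z) * Real.exp (-cumRate U ε z s)) by
    rw [← lintegral_map (f := H) hH hT.ennreal_toReal, h,
      lintegral_withDensity_eq_lintegral_mul _ hc hH]
    rfl
  have hfin : IsFiniteMeasure (((expMeasure 1).restrict {e | reflectTime U ε z e < ⊤}).map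
      (fun e => (reflectTime U ε z e).toReal)) := inferInstance
  refine Measure.ext_of_Iic _ _ fun t => ?_
  rw [Measure.map_apply hT.ennreal_toReal measurableSet_Iic,
    Measure.restrict_apply (hT.ennreal_toReal measurableSet_Iic),
    withDensity_apply _ measurableSet_Iic, Measure.restrict_restrict measurableSet_Iic,
    Set.inter_comm (Set.Iic t), Set.Ioi_inter_Iic]
  rcases le_or_gt t 0 with ht | ht
  · rw [Set.Ioc_eq_empty (not_lt.2 ht), Measure.restrict_empty, lintegral_zero_measure]
    refine measure_eq_zero_iff_ae_notMem.2 ?_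
    filter_upwards [ae_expMeasure_one_pos] with e he h
    have h1 := ENNReal.toReal_pos (reflectTime_pos hU hper hε z he).ne' (ne_of_lt h.2)
    exact absurd (h.1 : _ ≤ t) (not_le.2 (ht.trans_lt h1))
  · rw [lintegral_rate_mul_exp_neg hU hper hε z ht.le,
      ← expMeasure_lt_reflectTime hU hper hε z ht.le,
      ← prob_compl_eq_one_sub (s := {e | ENNReal.ofReal t < reflectTime U ε z e})
        (hT measurableSet_Ioi)]
    congr 1
    ext e
    simp only [Set.mem_inter_iff, Set.mem_preimage, Set.mem_Iic, Set.mem_ofPred_eq,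
      Set.mem_compl_iff, not_lt]
    refine ⟨fun h => ?_, fun h => ⟨?_, h.trans_lt ENNReal.ofReal_lt_top⟩⟩
    · exact (ENNReal.le_ofReal_iff_toReal_le h.2.ne ht.le).2 h.1
    · exact (ENNReal.le_ofReal_iff_toReal_le (h.trans_lt ENNReal.ofReal_lt_top).ne ht.le).1 h

end

/-! ### The jump operator and the law of one step -/

/-- The jump part of the generator, `B g (x, y) = (y · ∇U(x))_+ / ε g(x, y^*) + r ∫ g(x, v) dv`. -/
def jumpOp (U : Space d → ℝ) (r ε : ℝ) (g : State d → ℝ≥0∞) (z : State d) : ℝ≥0∞ :=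
  ENNReal.ofReal (rate U ε z) * g (z.1, reflect U z.1 z.2) +
    ENNReal.ofReal r * ∫⁻ v, g (z.1, v) ∂uniformSphere d

/-- The free flow killed at the jump rate. -/
def killed (U : Space d → ℝ) (r ε : ℝ) (t : ℝ) (g : State d → ℝ≥0∞) (z : State d) : ℝ≥0∞ :=
  ENNReal.ofReal (Real.exp (-(cumRate U ε z t + r * t))) * g (flow t z)

/-- The expectation of `Φ (t - T₁) Z_{T₁}`, where `T₁` is the first jump time. -/
def step (U : Space d → ℝ) (r ε : ℝ) (Φ : ℝ → State d → ℝ≥0∞) (t : ℝ) (z : State d) : ℝ≥0∞ :=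
  ∫⁻ s in Set.Ioi 0, killed U r ε s (jumpOp U r ε (Φ (t - s))) z

attribute [irreducible] jumpOp killed step

/-! ### Joint measurability of the operators -/

theorem measurable_reflect {U : Space d → ℝ} (hU : ContDiff ℝ 1 U) :
    Measurable fun z : State d => reflect U z.1 z.2 := by
  have h1 : Measurable fun z : State d => (z.2 : Space d) :=
    measurable_subtype_coe.comp measurable_snd
  have h2 : Measurable fun z : State d => grad U z.1 := (measurable_grad hU).comp measurable_fst
  have h3 : Measurable fun z : State d => ‖grad U z.1‖⁻¹ • grad U z.1 := h2.norm.inv.smul h2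
  have h4 : Measurable fun z : State d =>
      2 * inner ℝ (z.2 : Space d) (‖grad U z.1‖⁻¹ • grad U z.1) := (h1.inner h3).const_mul 2
  exact Measurable.subtype_mk (h1.sub (h4.smul h3))

section

variable {U : Space d → ℝ} {r ε : ℝ} (hU : ContDiff ℝ 1 U)

include hU in
theorem measurable_jumpOp {α : Type*} [MeasurableSpace α] [NeZero d] {g : α → State d → ℝ≥0∞}
    (hg : Measurable (Function.uncurry g)) :
    Measurable fun p : α × State d => jumpOp U r ε (g p.1) p.2 := by
  unfold jumpOp
  refine Measurable.add (Measurable.mul ?_ ?_) (Measurable.const_mul ?_ _)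
  · exact ((measurable_rate hU).comp measurable_snd).ennreal_ofReal
  · exact hg.comp (measurable_fst.prodMk (measurable_snd.fst.prodMk
      ((measurable_reflect hU).comp measurable_snd)))
  · refine Measurable.lintegral_prod_right (f := fun (p : α × State d) (v : UnitSphere d) =>
      g p.1 (p.2.1, v)) ?_
    exact hg.comp (measurable_fst.fst.prodMk (measurable_fst.snd.fst.prodMk measurable_snd))

include hU in
theorem measurable_jumpOp_right [NeZero d] {f : State d → ℝ≥0∞} (hf : Measurable f) :
    Measurable (jumpOp U r ε f) := by
  have h0 : Measurable (Function.uncurry fun (_ : Unit) => f) := hf.comp measurable_snd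
  have h1 := measurable_jumpOp (r := r) (ε := ε) hU h0
  have h2 : Measurable fun z : State d => ((), z) := by fun_prop
  exact h1.comp h2

variable (hper : IsPeriodic U)
include hU hper

theorem measurable_killed {α : Type*} [MeasurableSpace α] {g : α → State d → ℝ≥0∞}
    (hg : Measurable (Function.uncurry g)) :
    Measurable fun p : (ℝ × α) × State d => killed U r ε p.1.1 (g p.1.2) p.2 := by
  have h1 : Measurable fun p : (ℝ × α) × State d => (p.2, p.1.1) := by fun_prop
  have h2 : Measurable fun p : (ℝ × α) × State d => cumRate U ε p.2 p.1.1 :=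
    (measurable_cumRate hU hper).comp h1
  have h3 : Measurable fun p : (ℝ × α) × State d => flow p.1.1 p.2 :=
    measurable_flow.comp (measurable_swap.comp h1)
  have h4 : Measurable fun p : (ℝ × α) × State d => g p.1.2 (flow p.1.1 p.2) :=
    hg.comp (measurable_fst.snd.prodMk h3)
  unfold killed
  exact ((h2.add (measurable_fst.fst.const_mul r)).neg.exp.ennreal_ofReal).mul h4

theorem measurable_killed_time {f : State d → ℝ≥0∞} (hf : Measurable f) :
    Measurable (Function.uncurry fun s => killed U r ε s f) := by
  have h0 : Measurable (Function.uncurry fun (_ : Unit) => f) := hf.comp measurable_snd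
  have h1 := measurable_killed (r := r) (ε := ε) hU hper h0
  have h2 : Measurable fun p : ℝ × State d => ((p.1, ()), p.2) := by fun_prop
  exact h1.comp h2

theorem measurable_killed_right {f : State d → ℝ≥0∞} (hf : Measurable f) (t : ℝ) :
    Measurable (killed U r ε t f) :=
  (measurable_killed_time (r := r) (ε := ε) hU hper hf).comp (measurable_prodMk_left (x := t))

/-- The extra parameter is needed later to integrate over the time elapsed since the last jump. -/
theorem measurable_step_param {α : Type*} [MeasurableSpace α] [NeZero d]
    {Φ : α → ℝ → State d → ℝ≥0∞} (hΦ : Measurable fun p : α × ℝ × State d => Φ p.1 p.2.1 p.2.2) :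
    Measurable fun p : α × ℝ × State d => step U r ε (Φ p.1) p.2.1 p.2.2 := by
  unfold step
  have h1 : Measurable (Function.uncurry fun (q : α × ℝ) => jumpOp U r ε (Φ q.1 q.2)) :=
    measurable_jumpOp (g := fun (q : α × ℝ) => Φ q.1 q.2) hU
      (hΦ.comp (measurable_fst.fst.prodMk (measurable_fst.snd.prodMk measurable_snd)))
  have h2 := measurable_killed (r := r) (ε := ε) hU hper h1
  have h3 : Measurable fun q : (α × ℝ × State d) × ℝ =>
      ((q.2, (q.1.1, q.1.2.1 - q.2)), q.1.2.2) := by fun_prop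
  exact (h2.comp h3).lintegral_prod_right'

theorem measurable_step [NeZero d] {Φ : ℝ → State d → ℝ≥0∞}
    (hΦ : Measurable (Function.uncurry Φ)) : Measurable (Function.uncurry (step U r ε Φ)) := by
  have h1 : Measurable fun p : Unit × ℝ × State d => Φ p.2.1 p.2.2 := hΦ.comp measurable_snd
  have h2 := measurable_step_param (r := r) (ε := ε) hU hper (Φ := fun _ => Φ) h1
  have h3 : Measurable fun p : ℝ × State d => ((), p) := by fun_prop
  exact h2.comp h3

theorem measurable_waitTime (hε : 0 < ε) :
    Measurable fun p : State d × Noise d => waitTime U r ε p.1 p.2 := by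
  unfold waitTime
  refine Measurable.ennreal_toReal (Measurable.min ?_ ?_)
  · exact (measurable_reflectTime hU hper hε).comp (measurable_fst.prodMk measurable_snd.fst)
  · exact (measurable_snd.snd.fst.div_const r).ennreal_ofReal

theorem measurable_afterJump (hε : 0 < ε) :
    Measurable fun p : State d × Noise d => afterJump U r ε p.1 p.2 := by
  unfold afterJump
  have hx : Measurable fun p : State d × Noise d => (flow (waitTime U r ε p.1 p.2) p.1).1 :=
    (measurable_flow.comp ((measurable_waitTime hU hper hε).prodMk measurable_fst)).fst
  refine Measurable.ite (measurableSet_lt ?_ ?_) (hx.prodMk ?_) (hx.prodMk measurable_snd.snd.snd)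
  · exact (measurable_reflectTime hU hper hε).comp (measurable_fst.prodMk measurable_snd.fst)
  · exact (measurable_snd.snd.fst.div_const r).ennreal_ofReal
  · exact (measurable_reflect hU).comp (hx.prodMk measurable_fst.snd)

/-! ### Law of the first jump -/

/-- Given `T = s`, the refreshment clock is still silent with probability `e^{-rs}`. Integrating out
`E₂` first leaves an integral against the law of `T`. -/
theorem lintegral_reflect_part (hr : 0 < r) (hε : 0 < ε) (z : State d) {Ψ : ℝ → ℝ≥0∞}
    (hΨ : Measurable Ψ) :
    ∫⁻ e₁, ∫⁻ e₂, {e | reflectTime U ε z e₁ < ENNReal.ofReal (e / r)}.indicator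
        (fun _ => Ψ (reflectTime U ε z e₁).toReal) e₂ ∂expMeasure 1 ∂expMeasure 1 =
      ∫⁻ s in Set.Ioi 0, ENNReal.ofReal (Real.exp (-(cumRate U ε z s + r * s))) *
        (ENNReal.ofReal (rate U ε (flow s z)) * Ψ s) := by
  have hT : Measurable (reflectTime U ε z) :=
    (measurable_reflectTime hU hper hε).comp measurable_prodMk_left
  have hS : MeasurableSet {e | reflectTime U ε z e < ⊤} := hT measurableSet_Iio
  have h1 : ∀ e₁, ∫⁻ e₂, {e | reflectTime U ε z e₁ < ENNReal.ofReal (e / r)}.indicator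
        (fun _ => Ψ (reflectTime U ε z e₁).toReal) e₂ ∂expMeasure 1 =
      {e | reflectTime U ε z e < ⊤}.indicator (fun e => Ψ (reflectTime U ε z e).toReal *
        ENNReal.ofReal (Real.exp (-(r * (reflectTime U ε z e).toReal)))) e₁ := fun e₁ => by
    by_cases h : reflectTime U ε z e₁ < ⊤
    · have hset : {e | reflectTime U ε z e₁ < ENNReal.ofReal (e / r)} =
          Set.Ioi (r * (reflectTime U ε z e₁).toReal) := by
        ext e
        rw [Set.mem_ofPred_eq, Set.mem_Ioi, ENNReal.lt_ofReal_iff_toReal_lt h.ne,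
          lt_div_iff₀ hr, mul_comm]
      rw [hset, lintegral_indicator_const measurableSet_Ioi, expMeasure_one_Ioi
        (mul_nonneg hr.le ENNReal.toReal_nonneg), Set.indicator_of_mem (by exact h)]
    · have hset : {e | reflectTime U ε z e₁ < ENNReal.ofReal (e / r)} = ∅ := by
        ext e
        have : reflectTime U ε z e₁ = ⊤ := not_lt_top_iff.1 h
        simp [this]
      rw [hset, Set.indicator_of_notMem (by exact h)]
      simp
  simp_rw [h1]
  rw [lintegral_indicator hS, lintegral_reflectTime hU hper hε z
    (H := fun s => Ψ s * ENNReal.ofReal (Real.exp (-(r * s))))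
    (hΨ.mul (by fun_prop))]
  refine lintegral_congr fun s => ?_
  rw [neg_add, Real.exp_add, ENNReal.ofReal_mul (rate_nonneg hε _),
    ENNReal.ofReal_mul (Real.exp_pos _).le]
  ring

/-- Here `E₁` is integrated out first: the reflection clock has not rung before `e₂ / r` with
probability `e^{-A(e₂ / r)}`. The substitution `e₂ = r s` then produces the factor `r`. -/
theorem lintegral_refresh_part (hr : 0 < r) (hε : 0 < ε) (z : State d) {G : ℝ → ℝ≥0∞}
    (hG : Measurable G) :
    ∫⁻ e₁, ∫⁻ e₂, {e | ENNReal.ofReal (e / r) ≤ reflectTime U ε z e₁}.indicator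
        (fun e => G (e / r)) e₂ ∂expMeasure 1 ∂expMeasure 1 =
      ∫⁻ s in Set.Ioi 0, ENNReal.ofReal (Real.exp (-(cumRate U ε z s + r * s))) *
        (ENNReal.ofReal r * G s) := by
  have hT : Measurable (reflectTime U ε z) :=
    (measurable_reflectTime hU hper hε).comp measurable_prodMk_left
  have hGr : Measurable fun e : ℝ => G (e / r) := hG.comp (measurable_id.div_const r)
  have hS : MeasurableSet {p : ℝ × ℝ | ENNReal.ofReal (p.2 / r) ≤ reflectTime U ε z p.1} :=
    measurableSet_le (measurable_snd.div_const r).ennreal_ofReal (hT.comp measurable_fst)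
  have hm : Measurable (Function.uncurry fun e₁ e₂ =>
      {e | ENNReal.ofReal (e / r) ≤ reflectTime U ε z e₁}.indicator (fun e => G (e / r)) e₂) :=
    (hGr.comp measurable_snd).indicator hS
  have hA : Measurable fun s => cumRate U ε z s := (continuous_cumRate hU hper z).measurable
  rw [lintegral_lintegral_swap hm.aemeasurable]
  have h1 : ∀ᵐ e₂ ∂expMeasure 1, ∫⁻ e₁,
      {e | ENNReal.ofReal (e / r) ≤ reflectTime U ε z e₁}.indicator (fun e => G (e / r)) e₂
        ∂expMeasure 1 = G (e₂ / r) * ENNReal.ofReal (Real.exp (-cumRate U ε z (e₂ / r))) := by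
    filter_upwards [ae_expMeasure_one_pos] with e₂ he
    rw [← expMeasure_le_reflectTime hU hper hε z (div_pos he hr),
      ← lintegral_indicator_const (s := {e | ENNReal.ofReal (e₂ / r) ≤ reflectTime U ε z e})
        (hT measurableSet_Ici)]
    rfl
  have hAr : Measurable fun e => G (e / r) *
      ENNReal.ofReal (Real.exp (-cumRate U ε z (e / r))) :=
    hGr.mul (hA.comp (measurable_id.div_const r)).neg.exp.ennreal_ofReal
  rw [lintegral_congr_ae h1, lintegral_expMeasure_one hAr]
  have himg : (fun s => r * s) '' Set.Ioi 0 = Set.Ioi 0 := by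
    rw [Set.image_mul_left_Ioi hr, mul_zero]
  rw [← himg, lintegral_image_eq_lintegral_abs_deriv_mul measurableSet_Ioi
    (f' := fun _ => r) (fun s _ => by simpa using ((hasDerivAt_id s).const_mul r).hasDerivWithinAt)
    (fun a _ b _ h => mul_left_cancel₀ hr.ne' h), himg]
  refine lintegral_congr fun s => ?_
  rw [abs_of_pos hr, mul_div_cancel_left₀ _ hr.ne', neg_add, Real.exp_add,
    ENNReal.ofReal_mul (Real.exp_pos _).le]
  ring

theorem lintegral_noiseLaw_step [NeZero d] (hr : 0 < r) (hε : 0 < ε) {Φ : ℝ → State d → ℝ≥0∞}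
    (hΦ : Measurable (Function.uncurry Φ)) (t : ℝ) (z : State d) :
    ∫⁻ w, Φ (t - waitTime U r ε z w) (afterJump U r ε z w) ∂noiseLaw d = step U r ε Φ t z := by
  have hT : Measurable (reflectTime U ε z) :=
    (measurable_reflectTime hU hper hε).comp measurable_prodMk_left
  set Ψ : ℝ → ℝ≥0∞ := fun s => Φ (t - s) ((flow s z).1, reflect U (flow s z).1 z.2) with hΨ
  set G : ℝ → UnitSphere d → ℝ≥0∞ := fun s v => Φ (t - s) ((flow s z).1, v) with hG
  have hfl : Measurable fun s => (flow s z).1 :=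
    (measurable_flow.comp (measurable_id.prodMk measurable_const)).fst
  have hΨm : Measurable Ψ := hΦ.comp ((measurable_id.const_sub t).prodMk
    (hfl.prodMk ((measurable_reflect hU).comp (hfl.prodMk measurable_const))))
  have hGm : Measurable (Function.uncurry G) := hΦ.comp ((measurable_fst.const_sub t).prodMk
    ((hfl.comp measurable_fst).prodMk measurable_snd))
  set A : Set (Noise d) := {w | reflectTime U ε z w.1 < ENNReal.ofReal (w.2.1 / r)} with hA
  set B : Set (Noise d) := {w | ENNReal.ofReal (w.2.1 / r) ≤ reflectTime U ε z w.1} with hB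
  have hSm : Measurable fun w : Noise d => ENNReal.ofReal (w.2.1 / r) :=
    (measurable_snd.fst.div_const r).ennreal_ofReal
  have hAm : MeasurableSet A := measurableSet_lt (hT.comp measurable_fst) hSm
  have hBm : MeasurableSet B := measurableSet_le hSm (hT.comp measurable_fst)
  set F₁ : Noise d → ℝ≥0∞ := A.indicator fun w => Ψ (reflectTime U ε z w.1).toReal with hF₁
  set F₂ : Noise d → ℝ≥0∞ := B.indicator fun w => G (w.2.1 / r) w.2.2 with hF₂
  have hF₁m : Measurable F₁ := (hΨm.comp (hT.comp measurable_fst).ennreal_toReal).indicator hAm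
  have hF₂m : Measurable F₂ :=
    (hGm.comp ((measurable_snd.fst.div_const r).prodMk measurable_snd.snd)).indicator hBm
  -- Positivity of `E₂` is what makes `(ENNReal.ofReal (E₂ / r)).toReal` equal to `E₂ / r`.
  have hpos : ∀ᵐ w ∂noiseLaw d, 0 < w.2.1 := by
    have h2 : ∀ᵐ q ∂(expMeasure 1).prod (uniformSphere d), 0 < q.1 :=
      Measure.quasiMeasurePreserving_fst.ae ae_expMeasure_one_pos
    exact Measure.quasiMeasurePreserving_snd.ae h2
  have hsum : ∀ᵐ w ∂noiseLaw d,
      Φ (t - waitTime U r ε z w) (afterJump U r ε z w) = F₁ w + F₂ w := by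
    filter_upwards [hpos] with w hw
    by_cases h : reflectTime U ε z w.1 < ENNReal.ofReal (w.2.1 / r)
    · have h1 : w ∈ A := h
      have h2 : w ∉ B := not_le.2 h
      have hw : waitTime U r ε z w = (reflectTime U ε z w.1).toReal := by
        rw [waitTime, min_eq_left h.le]
      rw [hF₁, hF₂, Set.indicator_of_mem h1, Set.indicator_of_notMem h2, add_zero, afterJump,
        if_pos h, hw]
    · have h1 : w ∉ A := h
      have h2 : w ∈ B := not_lt.1 h
      have hw : waitTime U r ε z w = w.2.1 / r := by
        rw [waitTime, min_eq_right (not_lt.1 h), ENNReal.toReal_ofReal (div_pos hw hr).le]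
      rw [hF₁, hF₂, Set.indicator_of_notMem h1, Set.indicator_of_mem h2, zero_add, afterJump,
        if_neg h, hw]
  rw [lintegral_congr_ae hsum, lintegral_add_left hF₁m, noiseLaw,
    lintegral_prod _ hF₁m.aemeasurable, lintegral_prod _ hF₂m.aemeasurable]
  have h1 : ∀ e₁, ∫⁻ q, F₁ (e₁, q) ∂(expMeasure 1).prod (uniformSphere d) =
      ∫⁻ e₂, {e | reflectTime U ε z e₁ < ENNReal.ofReal (e / r)}.indicator
        (fun _ => Ψ (reflectTime U ε z e₁).toReal) e₂ ∂expMeasure 1 := fun e₁ => by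
    have hm : Measurable fun q : ℝ × UnitSphere d => F₁ (e₁, q) :=
      hF₁m.comp measurable_prodMk_left
    rw [lintegral_prod _ hm.aemeasurable]
    refine lintegral_congr fun e₂ => ?_
    have : ∀ v, F₁ (e₁, e₂, v) = {e | reflectTime U ε z e₁ < ENNReal.ofReal (e / r)}.indicator
        (fun _ => Ψ (reflectTime U ε z e₁).toReal) e₂ := fun v => rfl
    simp [this]
  have h2 : ∀ e₁, ∫⁻ q, F₂ (e₁, q) ∂(expMeasure 1).prod (uniformSphere d) =
      ∫⁻ e₂, {e | ENNReal.ofReal (e / r) ≤ reflectTime U ε z e₁}.indicator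
        (fun e => ∫⁻ v, G (e / r) v ∂uniformSphere d) e₂ ∂expMeasure 1 := fun e₁ => by
    have hm : Measurable fun q : ℝ × UnitSphere d => F₂ (e₁, q) :=
      hF₂m.comp measurable_prodMk_left
    rw [lintegral_prod _ hm.aemeasurable]
    refine lintegral_congr fun e₂ => ?_
    by_cases h : ENNReal.ofReal (e₂ / r) ≤ reflectTime U ε z e₁
    · rw [Set.indicator_of_mem (by exact h)]
      refine lintegral_congr fun v => ?_
      rw [hF₂, Set.indicator_of_mem (by exact h)]
    · rw [Set.indicator_of_notMem (by exact h)]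
      have : ∀ v, F₂ (e₁, e₂, v) = 0 := fun v => by
        rw [hF₂, Set.indicator_of_notMem (by exact h)]
      simp [this]
  simp_rw [h1, h2]
  rw [lintegral_reflect_part hU hper hr hε z hΨm,
    lintegral_refresh_part hU hper hr hε z (G := fun s => ∫⁻ v, G s v ∂uniformSphere d)
      hGm.lintegral_prod_right', ← lintegral_add_left]
  · rw [step]
    refine lintegral_congr fun s => ?_
    rw [killed, jumpOp, ← mul_add]
    rfl
  · have hA : Measurable fun s => cumRate U ε z s := (continuous_cumRate hU hper z).measurable
    have hR : Measurable fun s => rate U ε (flow s z) :=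
      (continuous_rate_flow hU hper z).measurable
    exact ((hA.add (measurable_id.const_mul r)).neg.exp.ennreal_ofReal).mul
      (hR.ennreal_ofReal.mul hΨm)

theorem noiseLaw_lt_waitTime [NeZero d] (hr : 0 < r) (hε : 0 < ε) {t : ℝ} (ht : 0 ≤ t)
    (z : State d) :
    noiseLaw d {w | t < waitTime U r ε z w} =
      ENNReal.ofReal (Real.exp (-(cumRate U ε z t + r * t))) := by
  have hset : {w : Noise d | t < waitTime U r ε z w} =
      {e | ENNReal.ofReal t < reflectTime U ε z e} ×ˢ (Set.Ioi (r * t) ×ˢ Set.univ) := by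
    ext w
    have hne : min (reflectTime U ε z w.1) (ENNReal.ofReal (w.2.1 / r)) ≠ ⊤ :=
      ((min_le_right _ _).trans_lt ENNReal.ofReal_lt_top).ne
    have hlt : ENNReal.ofReal t < ENNReal.ofReal (w.2.1 / r) ↔ t < w.2.1 / r :=
      ENNReal.ofReal_lt_ofReal_iff_of_nonneg ht
    simp only [Set.mem_ofPred_eq, Set.mem_prod, Set.mem_Ioi, Set.mem_univ, and_true, waitTime]
    rw [← ENNReal.ofReal_lt_iff_lt_toReal ht hne, lt_min_iff, hlt, lt_div_iff₀ hr, mul_comm]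
  rw [hset, noiseLaw, Measure.prod_prod, Measure.prod_prod, measure_univ, mul_one,
    expMeasure_lt_reflectTime hU hper hε z ht, expMeasure_one_Ioi (mul_nonneg hr.le ht),
    ← ENNReal.ofReal_mul (Real.exp_pos _).le, ← Real.exp_add, neg_add]

end

/-! ### Sequences of independent variables -/

/-- The sequence with first term `a` and the further terms `w`. -/
def consSeq {α : Type*} (a : α) (w : ℕ → α) : ℕ → α
  | 0 => a
  | k + 1 => w k

theorem measurable_consSeq {α : Type*} [MeasurableSpace α] :
    Measurable fun p : α × (ℕ → α) => consSeq p.1 p.2 := by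
  refine measurable_pi_lambda _ fun k => ?_
  cases k with
  | zero => exact measurable_fst
  | succ k => exact (measurable_pi_apply k).comp measurable_snd

/-- The product law is determined by finite cylinders, and a cylinder splits into its constraint at
index `0` and a shifted cylinder. -/
theorem map_consSeq_infinitePi {α : Type*} [MeasurableSpace α] (μ : Measure α)
    [IsProbabilityMeasure μ] :
    (μ.prod (Measure.infinitePi fun _ : ℕ => μ)).map (fun p => consSeq p.1 p.2) =
      Measure.infinitePi fun _ : ℕ => μ := by
  refine Measure.eq_infinitePi _ fun s t ht => ?_
  rw [Measure.map_apply measurable_consSeq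
    (MeasurableSet.pi s.countable_toSet fun i _ => ht i)]
  set s' : Finset ℕ := s.preimage Nat.succ (Nat.succ_injective.injOn) with hs'
  set t₀ : Set α := if 0 ∈ s then t 0 else Set.univ with ht₀
  have hset : (fun p : α × (ℕ → α) => consSeq p.1 p.2) ⁻¹' (s : Set ℕ).pi t =
      t₀ ×ˢ (s' : Set ℕ).pi fun k => t (k + 1) := by
    ext p
    simp only [Set.mem_preimage, Set.mem_pi, Set.mem_prod, SetLike.mem_coe, hs', ht₀,
      Finset.mem_preimage]
    constructor
    · intro h
      refine ⟨?_, fun k hk => h (k + 1) hk⟩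
      split_ifs with h0
      · exact h 0 h0
      · trivial
    · rintro ⟨h0, h1⟩ i hi
      cases i with
      | zero =>
        change p.1 ∈ t 0
        simpa [hi] using h0
      | succ k => exact h1 k hi
  rw [hset, Measure.prod_prod, Measure.infinitePi_pi _ fun i _ => ht (i + 1)]
  have himg : s.erase 0 = s'.map ⟨Nat.succ, Nat.succ_injective⟩ := by
    ext i
    cases i with
    | zero => simp
    | succ k => simp [hs']
  have hprod : ∏ i ∈ s', μ (t (i + 1)) = ∏ i ∈ s.erase 0, μ (t i) := by
    rw [himg, Finset.prod_map]; rfl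
  rw [hprod, ht₀]
  split_ifs with h0
  · exact Finset.mul_prod_erase s (fun i => μ (t i)) h0
  · rw [measure_univ, one_mul, Finset.erase_eq_of_notMem h0]

theorem lintegral_infinitePi_consSeq {α : Type*} [MeasurableSpace α] (μ : Measure α)
    [IsProbabilityMeasure μ] {F : (ℕ → α) → ℝ≥0∞} (hF : Measurable F) :
    ∫⁻ w, F w ∂Measure.infinitePi (fun _ : ℕ => μ) =
      ∫⁻ a, ∫⁻ w, F (consSeq a w) ∂Measure.infinitePi (fun _ : ℕ => μ) ∂μ := by
  conv_lhs => rw [← map_consSeq_infinitePi μ]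
  rw [lintegral_map hF measurable_consSeq, lintegral_prod]
  exact (hF.comp measurable_consSeq).aemeasurable

/-! ### The jump chain -/

section

variable {U : Space d → ℝ} {r ε : ℝ}

theorem waitTime_nonneg (z : State d) (w : Noise d) : 0 ≤ waitTime U r ε z w :=
  ENNReal.toReal_nonneg

/-- Renewal at the first jump: the chain restarts from the state after it, driven by the shifted
noise. -/
theorem jumpChain_consSeq (z : State d) (a : Noise d) (w : ℕ → Noise d) (n : ℕ) :
    jumpChain U r ε z (consSeq a w) (n + 1) =
      (waitTime U r ε z a + (jumpChain U r ε (afterJump U r ε z a) w n).1,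
        (jumpChain U r ε (afterJump U r ε z a) w n).2) := by
  induction n with
  | zero => simp [jumpChain, consSeq]
  | succ n ih =>
    rw [jumpChain, ih]
    simp [jumpChain, consSeq, add_assoc]

theorem monotone_jumpChain_fst (z : State d) (w : ℕ → Noise d) :
    Monotone fun n => (jumpChain U r ε z w n).1 :=
  monotone_nat_of_le_succ fun _ => le_add_of_nonneg_right (waitTime_nonneg _ _)

theorem jumpCount_eq {z : State d} {w : ℕ → Noise d} {t : ℝ} {n : ℕ}
    (h1 : (jumpChain U r ε z w n).1 ≤ t) (h2 : t < (jumpChain U r ε z w (n + 1)).1) :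
    jumpCount U r ε z w t = n := by
  have hset : {m : ℕ | (jumpChain U r ε z w m).1 ≤ t} = Set.Iic n := by
    ext m
    rw [Set.mem_ofPred_eq, Set.mem_Iic]
    refine ⟨fun hm => ?_, fun hm => (monotone_jumpChain_fst z w hm).trans h1⟩
    by_contra! hlt
    exact absurd (h2.trans_le ((monotone_jumpChain_fst z w hlt).trans hm)) (lt_irrefl _)
  rw [jumpCount, hset, csSup_Iic]

theorem exists_jumpChain_of_not_forall {z : State d} {w : ℕ → Noise d} {t : ℝ} (ht : 0 ≤ t)
    (h : ¬∀ n, (jumpChain U r ε z w n).1 ≤ t) :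
    ∃ n, (jumpChain U r ε z w n).1 ≤ t ∧ t < (jumpChain U r ε z w (n + 1)).1 := by
  by_contra! hc
  refine h fun n => ?_
  induction n with
  | zero => exact ht
  | succ n ih => exact hc n ih

theorem jumpCount_of_forall {z : State d} {w : ℕ → Noise d} {t : ℝ}
    (h : ∀ n, (jumpChain U r ε z w n).1 ≤ t) : jumpCount U r ε z w t = 0 := by
  have hset : {m : ℕ | (jumpChain U r ε z w m).1 ≤ t} = Set.univ := by
    ext m; simp [h m]
  rw [jumpCount, hset]
  exact Nat.sSup_of_not_bddAbove not_bddAbove_univ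

/-- The second set is the explosion event, where `sSup` of an unbounded set of naturals takes the
default value `0`. -/
theorem jumpCount_preimage {t : ℝ} (ht : 0 ≤ t) (n : ℕ) :
    (fun q : State d × (ℕ → Noise d) => jumpCount U r ε q.1 q.2 t) ⁻¹' {n} =
      {q | (jumpChain U r ε q.1 q.2 n).1 ≤ t ∧ t < (jumpChain U r ε q.1 q.2 (n + 1)).1} ∪
        {q | n = 0 ∧ ∀ m, (jumpChain U r ε q.1 q.2 m).1 ≤ t} := by
  ext q
  simp only [Set.mem_preimage, Set.mem_singleton_iff, Set.mem_union, Set.mem_ofPred_eq]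
  constructor
  · intro h
    by_cases hall : ∀ m, (jumpChain U r ε q.1 q.2 m).1 ≤ t
    · exact Or.inr ⟨h.symm.trans (jumpCount_of_forall hall), hall⟩
    · obtain ⟨m, h1, h2⟩ := exists_jumpChain_of_not_forall ht hall
      rw [jumpCount_eq h1 h2] at h
      exact Or.inl (h ▸ ⟨h1, h2⟩)
  · rintro (⟨h1, h2⟩ | ⟨rfl, h⟩)
    · exact jumpCount_eq h1 h2
    · exact jumpCount_of_forall h

variable (hU : ContDiff ℝ 1 U) (hper : IsPeriodic U)
include hU hper

theorem measurable_jumpChain (hε : 0 < ε) (n : ℕ) :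
    Measurable fun q : State d × (ℕ → Noise d) => jumpChain U r ε q.1 q.2 n := by
  induction n with
  | zero => exact measurable_const.prodMk measurable_fst
  | succ n ih =>
    have hw : Measurable fun q : State d × (ℕ → Noise d) =>
        ((jumpChain U r ε q.1 q.2 n).2, q.2 n) :=
      ih.snd.prodMk ((measurable_pi_apply n).comp measurable_snd)
    have h1 := (measurable_waitTime (r := r) hU hper hε).comp hw
    have h2 := (measurable_afterJump (r := r) hU hper hε).comp hw
    exact (ih.fst.add h1).prodMk h2

theorem measurable_process (hε : 0 < ε) {t : ℝ} (ht : 0 ≤ t) :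
    Measurable fun q : State d × (ℕ → Noise d) => process U r ε q.1 q.2 t := by
  have hT := fun n => (measurable_jumpChain (r := r) hU hper hε n).fst
  have hN : Measurable fun q : State d × (ℕ → Noise d) => jumpCount U r ε q.1 q.2 t := by
    refine measurable_to_countable' fun n => ?_
    rw [jumpCount_preimage ht]
    refine MeasurableSet.union ((measurableSet_le (hT n) measurable_const).inter
      (measurableSet_lt measurable_const (hT (n + 1)))) ?_
    by_cases hn : n = 0
    · simp only [hn, true_and]
      have : {q : State d × (ℕ → Noise d) | ∀ m, (jumpChain U r ε q.1 q.2 m).1 ≤ t} =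
          ⋂ m, {q | (jumpChain U r ε q.1 q.2 m).1 ≤ t} := by ext; simp
      rw [this]
      exact MeasurableSet.iInter fun m => measurableSet_le (hT m) measurable_const
    · simp [hn]
  have hm : Measurable fun p : ℕ × (State d × (ℕ → Noise d)) =>
      jumpChain U r ε p.2.1 p.2.2 p.1 :=
    measurable_from_prod_countable_right fun n => measurable_jumpChain hU hper hε n
  have h2 := hm.comp (hN.prodMk measurable_id)
  simp only [Function.comp_def, id] at h2
  unfold process
  exact measurable_flow_comp (h2.fst.const_sub t) h2.snd

variable [NeZero d]

theorem measurable_iterate_step {Φ : ℝ → State d → ℝ≥0∞}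
    (hΦ : Measurable (Function.uncurry Φ)) (n : ℕ) :
    Measurable (Function.uncurry ((step U r ε)^[n] Φ)) := by
  induction n with
  | zero => exact hΦ
  | succ n ih =>
    rw [Function.iterate_succ_apply']
    exact measurable_step hU hper ih

/-- By induction, peeling off the first noise variable: each jump contributes one application of
`step`, and `w n`, independent of the first `n` jumps, is averaged last. -/
theorem lintegral_jumpChain (hr : 0 < r) (hε : 0 < ε) {F : ℝ → State d → Noise d → ℝ≥0∞}
    (hF : Measurable fun p : ℝ × State d × Noise d => F p.1 p.2.1 p.2.2) (n : ℕ) (t : ℝ)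
    (z : State d) :
    ∫⁻ w, F (t - (jumpChain U r ε z w n).1) (jumpChain U r ε z w n).2 (w n)
        ∂Measure.infinitePi (fun _ : ℕ => noiseLaw d) =
      (step U r ε)^[n] (fun u z => ∫⁻ a, F u z a ∂noiseLaw d) t z := by
  have hI : Measurable (Function.uncurry fun u z => ∫⁻ a, F u z a ∂noiseLaw d) := by
    have : Measurable fun q : (ℝ × State d) × Noise d => F q.1.1 q.1.2 q.2 :=
      hF.comp (measurable_fst.fst.prodMk (measurable_fst.snd.prodMk measurable_snd))
    exact this.lintegral_prod_right'
  induction n generalizing t z with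
  | zero =>
    have hm : Measurable fun a => F t z a :=
      hF.comp (measurable_const.prodMk (measurable_const.prodMk measurable_id))
    have := (measurePreserving_eval_infinitePi (fun _ : ℕ => noiseLaw d) 0).lintegral_comp hm
    simpa [jumpChain] using this
  | succ n ih =>
    have hm : Measurable fun w : ℕ → Noise d =>
        F (t - (jumpChain U r ε z w (n + 1)).1) (jumpChain U r ε z w (n + 1)).2 (w (n + 1)) := by
      have h := (measurable_jumpChain (r := r) hU hper hε (n + 1)).comp
        (measurable_prodMk_left (x := z))
      exact hF.comp ((h.fst.const_sub t).prodMk (h.snd.prodMk (measurable_pi_apply (n + 1))))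
    rw [lintegral_infinitePi_consSeq _ hm, Function.iterate_succ_apply',
      ← lintegral_noiseLaw_step hU hper hr hε (measurable_iterate_step hU hper hI n)]
    refine lintegral_congr fun a => ?_
    rw [← ih]
    refine lintegral_congr fun w => ?_
    rw [jumpChain_consSeq, sub_add_eq_sub_sub]
    rfl

/-! ### There are finitely many jumps in finite time -/

omit [NeZero d] in
-- The integrand is the density of the minimum of the first jump time and an independent clock of
-- rate `1`.
theorem lintegral_totalRate_mul_exp_le (hr : 0 < r) (hε : 0 < ε) (z : State d) :
    ∫⁻ s in Set.Ioi 0, ENNReal.ofReal ((rate U ε (flow s z) + r + 1) *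
      Real.exp (-(cumRate U ε z s + r * s + s))) ≤ 1 := by
  have hF : ∀ s, HasDerivAt (fun s => -Real.exp (-(cumRate U ε z s + r * s + s)))
      ((rate U ε (flow s z) + r + 1) * Real.exp (-(cumRate U ε z s + r * s + s))) s := fun s => by
    have h := (((hasDerivAt_cumRate (ε := ε) hU hper z s).add
      ((hasDerivAt_id s).const_mul r)).add (hasDerivAt_id s)).neg.exp.neg
    rw [mul_one] at h
    rw [mul_comm, ← neg_neg (Real.exp _ * _), ← mul_neg]
    exact h
  have hpos : ∀ s, 0 ≤ (rate U ε (flow s z) + r + 1) *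
      Real.exp (-(cumRate U ε z s + r * s + s)) := fun s => by
    have := rate_nonneg (U := U) hε (flow s z)
    positivity
  have hlim : Filter.Tendsto (fun s => -Real.exp (-(cumRate U ε z s + r * s + s))) Filter.atTop
      (nhds 0) := by
    rw [← neg_zero]
    refine Filter.Tendsto.neg (Real.tendsto_exp_atBot.comp (Filter.tendsto_neg_atTop_atBot.comp
      (Filter.tendsto_atTop_mono' _ ?_ Filter.tendsto_id)))
    filter_upwards [Filter.eventually_ge_atTop 0] with s hs
    have h0 : 0 ≤ cumRate U ε z s := by
      simpa [cumRate_zero] using monotone_cumRate hU hper hε z hs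
    have : 0 ≤ r * s := by positivity
    simp only [id]
    linarith
  have hi := integrableOn_Ioi_deriv_of_nonneg' (a := 0) (fun s _ => hF s) (fun s _ => hpos s) hlim
  rw [← ofReal_integral_eq_lintegral_ofReal hi (ae_of_all _ hpos),
    integral_Ioi_of_hasDerivAt_of_nonneg' (fun s _ => hF s) (fun s _ => hpos s) hlim]
  simp [cumRate_zero]

/-- A jump beats an independent clock of rate `1` with probability at most `q = (M/ε + r) / (M/ε + r
+ 1)`, since the jump rate is at most `M/ε + r`. So each application of `step` gains a factor `q` on
functions of growth `e^u`. -/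
theorem step_le_of_le_exp {M : ℝ} (hM : ∀ x, ‖grad U x‖ ≤ M) (hr : 0 < r) (hε : 0 < ε)
    {Φ : ℝ → State d → ℝ≥0∞} {c : ℝ} (hc : 0 ≤ c)
    (hΦ : ∀ u z, Φ u z ≤ ENNReal.ofReal (c * Real.exp u)) (t : ℝ) (z : State d) :
    step U r ε Φ t z ≤
      ENNReal.ofReal ((M / ε + r) / (M / ε + r + 1) * c * Real.exp t) := by
  have hM0 : 0 ≤ M := (norm_nonneg _).trans (hM z.1)
  set q := (M / ε + r) / (M / ε + r + 1) with hq
  have hq0 : 0 ≤ q := by positivity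
  have hle : ∀ s, killed U r ε s (jumpOp U r ε (Φ (t - s))) z ≤
      ENNReal.ofReal (q * c * Real.exp t) * ENNReal.ofReal ((rate U ε (flow s z) + r + 1) *
        Real.exp (-(cumRate U ε z s + r * s + s))) := fun s => by
    have hR := rate_nonneg (U := U) hε (flow s z)
    have hR' := rate_le hM hε (flow s z)
    -- This is the monotonicity of `x / (x + 1)`.
    have hqR : rate U ε (flow s z) + r ≤ q * (rate U ε (flow s z) + r + 1) := by
      rw [hq, div_mul_eq_mul_div, le_div_iff₀ (by positivity)]
      nlinarith
    have h1 : jumpOp U r ε (Φ (t - s)) (flow s z) ≤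
        ENNReal.ofReal ((rate U ε (flow s z) + r) * (c * Real.exp (t - s))) := by
      rw [jumpOp, add_mul, ENNReal.ofReal_add (by positivity) (by positivity),
        ENNReal.ofReal_mul hR, ENNReal.ofReal_mul hr.le]
      refine add_le_add (mul_le_mul_right (hΦ _ _) _) (mul_le_mul_right ?_ _)
      refine (lintegral_mono fun v => hΦ _ _).trans ?_
      simp
    rw [killed, ← ENNReal.ofReal_mul (by positivity)]
    refine (mul_le_mul_right h1 _).trans ?_
    rw [← ENNReal.ofReal_mul (by positivity)]
    refine ENNReal.ofReal_le_ofReal ?_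
    rw [Real.exp_sub, neg_add _ s, Real.exp_add, Real.exp_neg s]
    have := mul_le_mul_of_nonneg_right hqR (a := Real.exp (-(cumRate U ε z s + r * s)) *
      (c * (Real.exp t / Real.exp s))) (by positivity)
    calc _ = (rate U ε (flow s z) + r) * (Real.exp (-(cumRate U ε z s + r * s)) *
          (c * (Real.exp t / Real.exp s))) := by ring
      _ ≤ _ := this
      _ = _ := by rw [div_eq_mul_inv]; ring
  rw [step]
  refine (lintegral_mono hle).trans ?_
  rw [lintegral_const_mul' _ _ ENNReal.ofReal_ne_top]
  exact mul_le_of_le_one_right' (lintegral_totalRate_mul_exp_le hU hper hr hε z)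

/-- Markov's inequality applied to `e^{t - T_n}`, whose mean is at most `q^n e^t` with `q < 1`. -/
theorem ae_exists_lt_jumpChain (hr : 0 < r) (hε : 0 < ε) (z : State d) (t : ℝ) :
    ∀ᵐ w ∂Measure.infinitePi (fun _ : ℕ => noiseLaw d),
      ¬∀ n, (jumpChain U r ε z w n).1 ≤ t := by
  obtain ⟨M, hM0, hM⟩ := exists_norm_grad_le hU
  set q := (M / ε + r) / (M / ε + r + 1) with hq
  have hq0 : 0 ≤ q := by positivity
  have hq1 : q < 1 := by rw [hq, div_lt_one (by positivity)]; linarith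
  have hiter : ∀ n u z, (step U r ε)^[n] (fun u _ => ENNReal.ofReal (Real.exp u)) u z ≤
      ENNReal.ofReal (q ^ n * Real.exp u) := fun n => by
    induction n with
    | zero => intro u z; simp
    | succ n ih =>
      intro u z
      rw [Function.iterate_succ_apply', pow_succ']
      exact step_le_of_le_exp hU hper hM hr hε (by positivity) ih u z
  have hexp : ∀ n, Measure.infinitePi (fun _ : ℕ => noiseLaw d)
      {w | ∀ n, (jumpChain U r ε z w n).1 ≤ t} ≤ ENNReal.ofReal (q ^ n * Real.exp t) := fun n => by
    have hm : Measurable fun p : ℝ × State d × Noise d => ENNReal.ofReal (Real.exp p.1) := by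
      fun_prop
    have h1 := lintegral_jumpChain hU hper hr hε
      (F := fun u _ _ => ENNReal.ofReal (Real.exp u)) hm n t z
    simp only [lintegral_const, measure_univ, mul_one] at h1
    refine le_trans ?_ (hiter n t z)
    rw [← h1]
    refine (measure_mono (t := {w | 1 ≤ ENNReal.ofReal
      (Real.exp (t - (jumpChain U r ε z w n).1))}) ?_).trans ?_
    · intro w hw
      rw [Set.mem_ofPred_eq] at hw ⊢
      rw [ENNReal.one_le_ofReal, Real.one_le_exp_iff]
      exact sub_nonneg.2 (hw n)
    · have h := (measurable_jumpChain (r := r) hU hper hε n).comp (measurable_prodMk_left (x := z))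
      have := mul_meas_ge_le_lintegral (μ := Measure.infinitePi (fun _ : ℕ => noiseLaw d))
        (f := fun w => ENNReal.ofReal (Real.exp (t - (jumpChain U r ε z w n).1)))
        ((h.fst.const_sub t).exp.ennreal_ofReal) 1
      rwa [one_mul] at this
  have hlim : Filter.Tendsto (fun n : ℕ => ENNReal.ofReal (q ^ n * Real.exp t)) Filter.atTop
      (nhds 0) := by
    rw [← ENNReal.ofReal_zero, ← zero_mul (Real.exp t)]
    exact ENNReal.tendsto_ofReal ((tendsto_pow_atTop_nhds_zero_of_lt_one hq0 hq1).mul_const _)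
  have h0 := le_antisymm (ge_of_tendsto' hlim hexp) (zero_le)
  exact measure_eq_zero_iff_ae_notMem.1 h0

/-! ### The transition operators -/

omit hU hper [NeZero d] in
/-- The part of the law at time `t` where no jump has occurred (zero for `t < 0`). -/
def noJump (U : Space d → ℝ) (r ε : ℝ) (f : State d → ℝ≥0∞) (t : ℝ) (z : State d) : ℝ≥0∞ :=
  if 0 ≤ t then killed U r ε t f z else 0

omit hU hper [NeZero d] in
/-- The part of the law at time `t` where exactly `n` jumps have occurred. -/
def dyson (U : Space d → ℝ) (r ε : ℝ) (n : ℕ) (f : State d → ℝ≥0∞) : ℝ → State d → ℝ≥0∞ :=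
  (step U r ε)^[n] (noJump U r ε f)

omit hU hper [NeZero d] in
/-- The transition operators `P_t` of the velocity jump process, as the sum over the number of
jumps. -/
def semigroup (U : Space d → ℝ) (r ε : ℝ) (t : ℝ) (f : State d → ℝ≥0∞) (z : State d) : ℝ≥0∞ :=
  ∑' n, dyson U r ε n f t z

theorem lintegral_process (hr : 0 < r) (hε : 0 < ε) {f : State d → ℝ≥0∞} (hf : Measurable f)
    {t : ℝ} (ht : 0 ≤ t) (z : State d) :
    ∫⁻ w, f (process U r ε z w t) ∂Measure.infinitePi (fun _ : ℕ => noiseLaw d) =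
      semigroup U r ε t f z := by
  classical
  -- With `u = t - T_n`, the condition says that `t` lies between the `n`-th jump and the next one,
  -- so exactly one `n` contributes.
  set F : ℝ → State d → Noise d → ℝ≥0∞ := fun u z a =>
    if 0 ≤ u ∧ u < waitTime U r ε z a then f (flow u z) else 0 with hF
  have hw := measurable_waitTime (r := r) hU hper hε
  have hFm : Measurable fun p : ℝ × State d × Noise d => F p.1 p.2.1 p.2.2 := by
    have h1 : Measurable fun p : ℝ × State d × Noise d => waitTime U r ε p.2.1 p.2.2 :=
      hw.comp measurable_snd
    have h2 : Measurable fun p : ℝ × State d × Noise d => f (flow p.1 p.2.1) :=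
      hf.comp (measurable_flow_comp (f := fun p : ℝ × State d × Noise d => p.1)
        (g := fun p => p.2.1) measurable_fst measurable_snd.fst)
    have h3 : MeasurableSet {p : ℝ × State d × Noise d | 0 ≤ p.1 ∧
        p.1 < waitTime U r ε p.2.1 p.2.2} :=
      (measurableSet_le measurable_const measurable_fst).inter (measurableSet_lt measurable_fst h1)
    simp only [hF]
    exact Measurable.ite h3 h2 measurable_const
  have hnoJump : (fun u z => ∫⁻ a, F u z a ∂noiseLaw d) = noJump U r ε f := by
    funext u z
    have hwz : Measurable fun a => waitTime U r ε z a := by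
      have h := hw.comp (measurable_prodMk_left (x := z))
      simpa only [Function.comp_def] using h
    rw [noJump]
    split_ifs with hu
    · rw [killed, ← noiseLaw_lt_waitTime hU hper hr hε hu z, mul_comm,
        ← lintegral_indicator_const (s := {w | u < waitTime U r ε z w})
          (measurableSet_lt measurable_const hwz)]
      refine lintegral_congr fun a => ?_
      simp only [hF, hu, true_and, Set.indicator_apply, Set.mem_ofPred_eq]
    · simp [hF, hu]
  have hsum : ∀ᵐ w ∂Measure.infinitePi (fun _ : ℕ => noiseLaw d), f (process U r ε z w t) =
      ∑' n, F (t - (jumpChain U r ε z w n).1) (jumpChain U r ε z w n).2 (w n) := by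
    filter_upwards [ae_exists_lt_jumpChain hU hper hr hε z t] with w hw
    obtain ⟨n, h1, h2⟩ := exists_jumpChain_of_not_forall ht hw
    rw [tsum_eq_single n]
    · rw [process, jumpCount_eq h1 h2]
      simp only [hF]
      rw [if_pos ⟨sub_nonneg.2 h1, sub_lt_iff_lt_add'.2 h2⟩]
    · intro m hm
      simp only [hF]
      refine if_neg fun ⟨h3, h4⟩ => hm ?_
      rw [← jumpCount_eq h1 h2, jumpCount_eq (sub_nonneg.1 h3) (sub_lt_iff_lt_add'.1 h4)]
  rw [lintegral_congr_ae hsum, lintegral_tsum, semigroup]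
  · refine tsum_congr fun n => ?_
    rw [lintegral_jumpChain hU hper hr hε hFm, hnoJump, dyson]
  · intro n
    have h := (measurable_jumpChain (r := r) hU hper hε n).comp (measurable_prodMk_left (x := z))
    exact (hFm.comp ((h.fst.const_sub t).prodMk
      (h.snd.prodMk (measurable_pi_apply n)))).aemeasurable

theorem lintegral_law (hr : 0 < r) (hε : 0 < ε) {f : State d → ℝ≥0∞} (hf : Measurable f)
    {t : ℝ} (ht : 0 ≤ t) (μ : Measure (State d)) [SFinite μ] :
    ∫⁻ z, f z ∂law U r ε μ t = ∫⁻ z, semigroup U r ε t f z ∂μ := by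
  have hp := measurable_process (r := r) hU hper hε ht
  have hfp : Measurable fun q : State d × (ℕ → Noise d) => f (process U r ε q.1 q.2 t) :=
    hf.comp hp
  rw [law, lintegral_map hf hp, lintegral_prod _ hfp.aemeasurable]
  exact lintegral_congr fun z => lintegral_process hU hper hr hε hf ht z

end

/-! ### Algebra of the Dyson expansion -/

section

variable {U : Space d → ℝ} {r ε : ℝ}

theorem killed_of_eq_zero {g : State d → ℝ≥0∞} (hg : ∀ z, g z = 0) (t : ℝ) (z : State d) :
    killed U r ε t g z = 0 := by
  rw [killed, hg, mul_zero]

theorem jumpOp_of_eq_zero {g : State d → ℝ≥0∞} (hg : ∀ z, g z = 0) (z : State d) :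
    jumpOp U r ε g z = 0 := by
  simp [jumpOp, hg]

theorem dyson_zero (f : State d → ℝ≥0∞) : dyson U r ε 0 f = noJump U r ε f := rfl

theorem dyson_succ (n : ℕ) (f : State d → ℝ≥0∞) :
    dyson U r ε (n + 1) f = step U r ε (dyson U r ε n f) :=
  Function.iterate_succ_apply' _ _ _

theorem dyson_of_neg (n : ℕ) (f : State d → ℝ≥0∞) {t : ℝ} (ht : t < 0) (z : State d) :
    dyson U r ε n f t z = 0 := by
  induction n generalizing t z with
  | zero => rw [dyson_zero, noJump, if_neg (not_le.2 ht)]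
  | succ n ih =>
    rw [dyson_succ, step]
    refine (setLIntegral_congr_fun measurableSet_Ioi fun s hs => ?_).trans lintegral_zero
    exact killed_of_eq_zero (jumpOp_of_eq_zero fun z => ih (by
      have : (0 : ℝ) < s := hs
      linarith) z) _ _

theorem dyson_succ_eq_setLIntegral (n : ℕ) (f : State d → ℝ≥0∞) (t : ℝ) (z : State d) :
    dyson U r ε (n + 1) f t z =
      ∫⁻ s in Set.Ioc 0 t, killed U r ε s (jumpOp U r ε (dyson U r ε n f (t - s))) z := by
  rw [dyson_succ, step, ← Set.Ioi_inter_Iic]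
  rw [← lintegral_indicator measurableSet_Ioi,
    ← lintegral_indicator (measurableSet_Ioi.inter measurableSet_Iic)]
  refine lintegral_congr fun s => ?_
  by_cases hs : s ≤ t
  · simp only [Set.indicator_apply, Set.mem_inter_iff, Set.mem_Iic, hs, and_true]
  · have hs' : s ∉ Set.Ioi (0 : ℝ) ∩ Set.Iic t := fun h => hs h.2
    rw [Set.indicator_of_notMem hs']
    refine Set.indicator_apply_eq_zero.2 fun _ => ?_
    refine killed_of_eq_zero (jumpOp_of_eq_zero fun z => dyson_of_neg n f ?_ z) _ _
    linarith

theorem step_shift (Φ : ℝ → State d → ℝ≥0∞) (s t : ℝ) (z : State d) :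
    step U r ε (fun t => Φ (t - s)) t z = step U r ε Φ (t - s) z := by
  rw [step, step]
  simp_rw [sub_right_comm]

theorem killed_sum {ι : Type*} (S : Finset ι) (g : ι → State d → ℝ≥0∞) (t : ℝ) (z : State d) :
    killed U r ε t (fun z => ∑ i ∈ S, g i z) z = ∑ i ∈ S, killed U r ε t (g i) z := by
  simp only [killed, Finset.mul_sum]

theorem killed_lintegral {α : Type*} [MeasurableSpace α] (μ : Measure α)
    (g : α → State d → ℝ≥0∞) (t : ℝ) (z : State d) :
    killed U r ε t (fun z => ∫⁻ a, g a z ∂μ) z = ∫⁻ a, killed U r ε t (g a) z ∂μ := by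
  simp only [killed]
  rw [lintegral_const_mul' _ _ ENNReal.ofReal_ne_top]

theorem jumpOp_sum {ι : Type*} (S : Finset ι) {g : ι → State d → ℝ≥0∞}
    (hg : ∀ i, Measurable (g i)) (z : State d) :
    jumpOp U r ε (fun z => ∑ i ∈ S, g i z) z = ∑ i ∈ S, jumpOp U r ε (g i) z := by
  simp only [jumpOp, Finset.sum_add_distrib, ← Finset.mul_sum]
  rw [lintegral_finsetSum]
  exact fun i _ => (hg i).comp measurable_prodMk_left

theorem jumpOp_lintegral [NeZero d] {α : Type*} [MeasurableSpace α] (μ : Measure α) [SFinite μ]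
    {g : α → State d → ℝ≥0∞} (hg : Measurable (Function.uncurry g)) (z : State d) :
    jumpOp U r ε (fun z => ∫⁻ a, g a z ∂μ) z = ∫⁻ a, jumpOp U r ε (g a) z ∂μ := by
  simp only [jumpOp]
  have h1 : Measurable fun a => g a (z.1, reflect U z.1 z.2) :=
    hg.comp (measurable_id.prodMk measurable_const)
  have h2 : Measurable fun p : UnitSphere d × α => g p.2 (z.1, p.1) :=
    hg.comp (measurable_snd.prodMk (measurable_const.prodMk measurable_fst))
  rw [lintegral_lintegral_swap h2.aemeasurable, lintegral_add_left (h1.const_mul _),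
    lintegral_const_mul' _ _ ENNReal.ofReal_ne_top, lintegral_const_mul' _ _ ENNReal.ofReal_ne_top]

variable (hU : ContDiff ℝ 1 U) (hper : IsPeriodic U)
include hU hper

theorem killed_killed (f : State d → ℝ≥0∞) (s t : ℝ) (z : State d) :
    killed U r ε t (killed U r ε s f) z = killed U r ε (t + s) f z := by
  rw [killed, killed, killed, ← mul_assoc, ← ENNReal.ofReal_mul (Real.exp_pos _).le,
    ← Real.exp_add, cumRate_add hU hper, flow_add]
  ring_nf

variable [NeZero d]

theorem step_lintegral {α : Type*} [MeasurableSpace α] (μ : Measure α) [SFinite μ]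
    {H : α → ℝ → State d → ℝ≥0∞} (hH : Measurable fun p : α × ℝ × State d => H p.1 p.2.1 p.2.2)
    (t : ℝ) (z : State d) :
    step U r ε (fun t z => ∫⁻ a, H a t z ∂μ) t z = ∫⁻ a, step U r ε (H a) t z ∂μ := by
  have h1 : Measurable (Function.uncurry fun (q : α × ℝ) => jumpOp U r ε (H q.1 q.2)) :=
    measurable_jumpOp (g := fun (q : α × ℝ) => H q.1 q.2) hU
      (hH.comp (measurable_fst.fst.prodMk (measurable_fst.snd.prodMk measurable_snd)))
  have h2 := measurable_killed (r := r) (ε := ε) hU hper h1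
  have h3 : Measurable fun q : ℝ × α => ((q.1, (q.2, t - q.1)), z) := by fun_prop
  simp only [step]
  have h4 : Measurable (Function.uncurry fun (s : ℝ) (a : α) =>
      killed U r ε s (jumpOp U r ε (H a (t - s))) z) := h2.comp h3
  rw [← lintegral_lintegral_swap h4.aemeasurable]
  refine lintegral_congr fun s => ?_
  rw [← killed_lintegral]
  congr 1
  funext z
  have h5 : Measurable (Function.uncurry fun (a : α) (z : State d) => H a (t - s) z) :=
    hH.comp (measurable_fst.prodMk (measurable_const.prodMk measurable_snd))
  exact jumpOp_lintegral μ h5 z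

theorem measurable_dyson_param {α : Type*} [MeasurableSpace α] {g : α → State d → ℝ≥0∞}
    (hg : Measurable (Function.uncurry g)) (n : ℕ) :
    Measurable fun p : α × ℝ × State d => dyson U r ε n (g p.1) p.2.1 p.2.2 := by
  induction n with
  | zero =>
    simp only [dyson_zero, noJump]
    have h1 := measurable_killed (r := r) (ε := ε) hU hper hg
    have h2 : Measurable fun p : α × ℝ × State d => ((p.2.1, p.1), p.2.2) := by fun_prop
    have h3 : MeasurableSet {p : α × ℝ × State d | 0 ≤ p.2.1} :=
      measurableSet_le measurable_const measurable_snd.fst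
    exact Measurable.ite h3 (h1.comp h2) measurable_const
  | succ n ih =>
    simp only [dyson_succ]
    exact measurable_step_param (Φ := fun a => dyson U r ε n (g a)) hU hper ih

theorem measurable_dyson {f : State d → ℝ≥0∞} (hf : Measurable f) (n : ℕ) :
    Measurable fun p : ℝ × State d => dyson U r ε n f p.1 p.2 := by
  have h1 := measurable_dyson_param (r := r) (ε := ε) hU hper (α := Unit) (g := fun _ => f)
    (hf.comp measurable_snd) n
  have h2 : Measurable fun p : ℝ × State d => ((), p) := by fun_prop
  exact h1.comp h2

theorem measurable_dyson_right {f : State d → ℝ≥0∞} (hf : Measurable f) (n : ℕ) (t : ℝ) :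
    Measurable (dyson U r ε n f t) :=
  (measurable_dyson (r := r) (ε := ε) hU hper hf n).comp (measurable_prodMk_left (x := t))

theorem measurable_semigroup {f : State d → ℝ≥0∞} (hf : Measurable f) (t : ℝ) :
    Measurable (semigroup U r ε t f) :=
  Measurable.tsum fun n => measurable_dyson_right hU hper hf n t

/-- Taken with the counting measure, this also moves infinite sums through the Dyson terms, as the
semigroup property requires. -/
theorem dyson_lintegral {α : Type*} [MeasurableSpace α] (μ : Measure α) [SFinite μ]
    {g : α → State d → ℝ≥0∞} (hg : Measurable (Function.uncurry g)) (n : ℕ) (t : ℝ)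
    (z : State d) :
    dyson U r ε n (fun z => ∫⁻ a, g a z ∂μ) t z = ∫⁻ a, dyson U r ε n (g a) t z ∂μ := by
  induction n generalizing t z with
  | zero =>
    simp only [dyson_zero, noJump]
    split_ifs
    · exact killed_lintegral μ g t z
    · simp
  | succ n ih =>
    simp only [dyson_succ]
    rw [← step_lintegral hU hper μ (measurable_dyson_param hU hper hg n)]
    congr 1
    funext t z
    exact ih t z

/-- The `n` jumps in `[0, t + s]` are distributed as `p.1` before time `t` and `p.2` after it. The
induction conditions on the first jump: if it occurs before `t`, the induction hypothesis applies to
the remaining time; if after `t`, then `p.1 = 0`. -/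
theorem dyson_add {f : State d → ℝ≥0∞} (hf : Measurable f) (n : ℕ) {s t : ℝ} (hs : 0 ≤ s)
    (ht : 0 ≤ t) (z : State d) :
    dyson U r ε n f (t + s) z =
      ∑ p ∈ Finset.HasAntidiagonal.antidiagonal n, dyson U r ε p.1 (dyson U r ε p.2 f s) t z := by
  induction n generalizing t z with
  | zero =>
    have h : noJump U r ε f s = killed U r ε s f := by
      funext z; rw [noJump, if_pos hs]
    simp only [Finset.Nat.antidiagonal_zero, Finset.sum_singleton, dyson_zero]
    rw [h, noJump, noJump, if_pos ht, if_pos (add_nonneg ht hs), killed_killed hU hper]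
  | succ n ih =>
    have hfirst : ∫⁻ u in Set.Ioc 0 t,
        killed U r ε u (jumpOp U r ε (dyson U r ε n f (t + s - u))) z =
          ∑ p ∈ Finset.HasAntidiagonal.antidiagonal n, dyson U r ε (p.1 + 1) (dyson U r ε p.2 f s) t z := by
      have h1 : ∀ u ∈ Set.Ioc 0 t,
          killed U r ε u (jumpOp U r ε (dyson U r ε n f (t + s - u))) z =
            ∑ p ∈ Finset.HasAntidiagonal.antidiagonal n, killed U r ε u
              (jumpOp U r ε (dyson U r ε p.1 (dyson U r ε p.2 f s) (t - u))) z := fun u hu => by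
        rw [← killed_sum]
        congr 1
        funext z
        rw [← jumpOp_sum _ fun p => measurable_dyson_right hU hper
          (measurable_dyson_right hU hper hf _ _) _ _]
        congr 1
        funext z
        rw [← ih (sub_nonneg.2 hu.2)]
        congr 1
        ring
      rw [setLIntegral_congr_fun measurableSet_Ioc h1, lintegral_finsetSum]
      · simp_rw [dyson_succ_eq_setLIntegral]
      · intro p _
        have hg := measurable_dyson (r := r) (ε := ε) hU hper
          (measurable_dyson_right (r := r) (ε := ε) hU hper hf p.2 s) p.1
        have hj : Measurable (Function.uncurry fun t =>
            jumpOp U r ε (dyson U r ε p.1 (dyson U r ε p.2 f s) t)) := measurable_jumpOp hU hg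
        have h2 := measurable_killed (r := r) (ε := ε) hU hper hj
        have h3 : Measurable fun u : ℝ => ((u, t - u), z) := by fun_prop
        exact h2.comp h3
    have hsecond : ∫⁻ u in Set.Ioi t,
        killed U r ε u (jumpOp U r ε (dyson U r ε n f (t + s - u))) z =
          dyson U r ε 0 (dyson U r ε (n + 1) f s) t z := by
      -- When the first jump comes after `t`, the killed flow up to time `t + u` factors through
      -- time `t`.
      have hmp : MeasurePreserving (fun u : ℝ => t + u) (volume.restrict (Set.Ioi 0))
          (volume.restrict (Set.Ioi t)) := by
        have := (measurePreserving_add_left (volume : Measure ℝ) t).restrict_preimage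
          (s := Set.Ioi t) measurableSet_Ioi
        simpa using this
      have hk : dyson U r ε (n + 1) f s = fun z => ∫⁻ u in Set.Ioi 0,
          killed U r ε u (jumpOp U r ε (dyson U r ε n f (s - u))) z := by
        funext z; rw [dyson_succ, step]
      rw [← hmp.lintegral_comp_emb (measurableEmbedding_addLeft t), dyson_zero, noJump,
        if_pos ht, hk, killed_lintegral]
      refine lintegral_congr fun u => ?_
      rw [killed_killed hU hper, add_sub_add_left_eq_sub]
    rw [dyson_succ, step, ← Set.Ioc_union_Ioi_eq_Ioi ht, lintegral_union measurableSet_Ioi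
      (Set.Ioc_disjoint_Ioi le_rfl), hfirst, hsecond, Finset.Nat.antidiagonal_succ]
    simp [add_comm]

theorem semigroup_add {f : State d → ℝ≥0∞} (hf : Measurable f) {s t : ℝ} (hs : 0 ≤ s)
    (ht : 0 ≤ t) (z : State d) :
    semigroup U r ε (t + s) f z = semigroup U r ε t (semigroup U r ε s f) z := by
  have h1 : ∀ k, dyson U r ε k (semigroup U r ε s f) t z =
      ∑' l, dyson U r ε k (dyson U r ε l f s) t z := fun k => by
    have := dyson_lintegral (r := r) (ε := ε) hU hper Measure.count
      (g := fun l => dyson U r ε l f s)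
      (measurable_from_prod_countable_right fun l => measurable_dyson_right hU hper hf l s) k t z
    simp only [lintegral_count] at this
    exact this
  rw [semigroup, semigroup]
  simp_rw [h1, dyson_add hU hper hf _ hs ht]
  rw [← ENNReal.tsum_prod, ← Finset.HasAntidiagonal.sigmaAntidiagonalEquivProd.tsum_eq, ENNReal.tsum_sigma']
  refine tsum_congr fun n => ?_
  rw [tsum_fintype, Finset.univ_eq_attach]
  exact (Finset.sum_attach _ fun p : ℕ × ℕ => dyson U r ε p.1 (dyson U r ε p.2 f s) t z).symm

/-- Decomposition at the last jump, `s` being the time elapsed since then, whereas the definition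
decomposes at the first jump. Time reversal exchanges the two. -/
theorem dyson_succ' {f : State d → ℝ≥0∞} (hf : Measurable f) (n : ℕ) (t : ℝ) (z : State d) :
    dyson U r ε (n + 1) f t z =
      ∫⁻ s in Set.Ioi 0, dyson U r ε n (jumpOp U r ε (killed U r ε s f)) (t - s) z := by
  have hk : Measurable (Function.uncurry fun s => killed U r ε s f) :=
    measurable_killed_time hU hper hf
  have hj : Measurable (Function.uncurry fun s => jumpOp U r ε (killed U r ε s f)) :=
    measurable_jumpOp hU hk
  induction n generalizing t z with
  | zero =>
    rw [dyson_succ_eq_setLIntegral, ← lintegral_indicator measurableSet_Ioc,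
      ← lintegral_sub_left_eq_self _ t, ← lintegral_indicator measurableSet_Ioi]
    refine lintegral_congr_ae ?_
    -- The reflection `s ↦ t - s` exchanges the open and closed ends of the interval, so the end
    -- points are discarded.
    have h0 : ∀ᵐ s : ℝ, s ≠ 0 ∧ s ≠ t :=
      (Measure.ae_ne volume 0).and (Measure.ae_ne volume t)
    filter_upwards [h0] with s hs
    have hmem : t - s ∈ Set.Ioc 0 t ↔ 0 < s ∧ s ≤ t := by
      rw [Set.mem_Ioc]
      refine ⟨fun h => ⟨lt_of_le_of_ne (by linarith) (Ne.symm hs.1), by linarith⟩, fun h => ⟨?_, by linarith⟩⟩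
      have := lt_of_le_of_ne h.2 hs.2
      linarith
    by_cases h : 0 < s ∧ s ≤ t
    · have hn : noJump U r ε f s = killed U r ε s f := by
        funext z; rw [noJump, if_pos h.1.le]
      rw [Set.indicator_of_mem (hmem.2 h), Set.indicator_of_mem (by exact h.1), dyson_zero,
        dyson_zero, noJump, if_pos (sub_nonneg.2 h.2), sub_sub_cancel, hn]
    · rw [Set.indicator_of_notMem (fun h' => h (hmem.1 h'))]
      by_cases h1 : 0 < s
      · rw [Set.indicator_of_mem (by exact h1), dyson_of_neg]
        have : ¬s ≤ t := fun h' => h ⟨h1, h'⟩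
        linarith
      · rw [Set.indicator_of_notMem (by exact h1)]
  | succ n ih =>
    have hm : Measurable fun p : ℝ × ℝ × State d =>
        dyson U r ε n (jumpOp U r ε (killed U r ε p.1 f)) (p.2.1 - p.1) p.2.2 := by
      have h1 := measurable_dyson_param (r := r) (ε := ε) hU hper hj n
      have h2 : Measurable fun p : ℝ × ℝ × State d => (p.1, p.2.1 - p.1, p.2.2) := by fun_prop
      exact h1.comp h2
    have h := step_lintegral (r := r) (ε := ε) hU hper (volume.restrict (Set.Ioi (0 : ℝ)))
      (H := fun s t z => dyson U r ε n (jumpOp U r ε (killed U r ε s f)) (t - s) z) hm t z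
    rw [dyson_succ]
    have hstep : dyson U r ε (n + 1) f = fun t z => ∫⁻ s in Set.Ioi 0,
        dyson U r ε n (jumpOp U r ε (killed U r ε s f)) (t - s) z := by
      funext t z; exact ih t z
    rw [hstep, h]
    refine lintegral_congr fun s => ?_
    rw [dyson_succ]
    exact step_shift (dyson U r ε n (jumpOp U r ε (killed U r ε s f))) s t z

end

/-! ### Isometries preserve the uniform law on the sphere -/

/-- The surface measure of a set is, up to a constant, the volume of the cone over it. A linear
isometry commutes with forming cones and preserves volume. -/
theorem measurePreserving_uniformSphere (e : Space d ≃ₗᵢ[ℝ] Space d)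
    {f : UnitSphere d → UnitSphere d} (hf : ∀ y, (f y : Space d) = e y) :
    MeasurePreserving f (uniformSphere d) (uniformSphere d) := by
  have hfm : Measurable f := by
    refine Measurable.subtype_mk (f := fun y => (f y : Space d)) ?_
    simp_rw [hf]
    exact e.continuous.measurable.comp measurable_subtype_coe
  suffices h : MeasurePreserving f (volume : Measure (Space d)).toSphere
      (volume : Measure (Space d)).toSphere from h.smul_measure _
  refine ⟨hfm, Measure.ext fun s hs => ?_⟩
  rw [Measure.map_apply hfm hs, Measure.toSphere_apply' _ hs, Measure.toSphere_apply' _ (hfm hs)]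
  congr 1
  have hset : Set.Ioo (0 : ℝ) 1 • ((↑) '' (f ⁻¹' s) : Set (Space d)) =
      e.toMeasurableEquiv ⁻¹' (Set.Ioo (0 : ℝ) 1 • ((↑) '' s)) := by
    ext v
    simp only [Set.mem_smul, Set.mem_image, Set.mem_preimage]
    constructor
    · rintro ⟨c, hc, _, ⟨y, hy, rfl⟩, rfl⟩
      exact ⟨c, hc, f y, ⟨f y, hy, rfl⟩, by rw [hf]; exact (map_smul e c _).symm⟩
    · rintro ⟨c, hc, _, ⟨y, hy, rfl⟩, hv⟩
      have hy1 : ‖e.symm y‖ = 1 := by rw [LinearIsometryEquiv.norm_map, norm_velocity]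
      refine ⟨c, hc, e.symm y, ⟨⟨e.symm y, mem_sphere_zero_iff_norm.2 hy1⟩, ?_, rfl⟩, ?_⟩
      · have : f ⟨e.symm y, mem_sphere_zero_iff_norm.2 hy1⟩ = y := Subtype.ext (by rw [hf]; simp)
        exact this.symm ▸ hy
      · apply e.injective
        rw [map_smul, e.apply_symm_apply]
        exact hv
  rw [hset]
  exact (show MeasurePreserving e.toMeasurableEquiv volume volume from
    e.measurePreserving).measure_preimage_equiv _

theorem reflectVec_eq_reflection (g y : Space d) :
    reflectVec g y = (ℝ ∙ g)ᗮ.reflection y := by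
  rw [Submodule.reflection_orthogonal_apply, Submodule.reflection_singleton_apply, reflectVec,
    real_inner_smul_right, smul_smul, real_inner_comm, neg_sub, two_smul, ← add_smul]
  congr 2
  simp
  ring

theorem measurePreserving_reflect (U : Space d → ℝ) (x : Torus d) :
    MeasurePreserving (reflect U x) (uniformSphere d) (uniformSphere d) :=
  measurePreserving_uniformSphere (ℝ ∙ grad U x)ᗮ.reflection
    fun y => reflectVec_eq_reflection (grad U x) y

theorem measurePreserving_neg_uniformSphere :
    MeasurePreserving (fun y : UnitSphere d => -y) (uniformSphere d) (uniformSphere d) :=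
  measurePreserving_uniformSphere (LinearIsometryEquiv.neg ℝ) fun _ => rfl

theorem reflect_reflect (U : Space d → ℝ) (x : Torus d) (y : UnitSphere d) :
    reflect U x (reflect U x y) = y := by
  refine Subtype.ext ?_
  change reflectVec (grad U x) (reflectVec (grad U x) y) = y
  rw [reflectVec_eq_reflection, reflectVec_eq_reflection, Submodule.reflection_reflection]

theorem reflect_neg (U : Space d → ℝ) (x : Torus d) (y : UnitSphere d) :
    reflect U x (-y) = -reflect U x y := by
  refine Subtype.ext ?_
  change reflectVec (grad U x) (-y) = -reflectVec (grad U x) y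
  rw [reflectVec_eq_reflection, reflectVec_eq_reflection, map_neg]

theorem inner_reflect_grad (U : Space d → ℝ) (x : Torus d) (y : UnitSphere d) :
    inner ℝ (reflect U x y : Space d) (grad U x) = -inner ℝ (y : Space d) (grad U x) := by
  change inner ℝ (reflectVec (grad U x) y) (grad U x) = _
  have hg : grad U x = -(ℝ ∙ grad U x)ᗮ.reflection (grad U x) := by
    rw [Submodule.reflection_orthogonalComplement_singleton_eq_neg, neg_neg]
  have h := LinearIsometryEquiv.inner_map_map (ℝ ∙ grad U x)ᗮ.reflection (y : Space d) (grad U x)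
  rw [reflectVec_eq_reflection, ← h, ← inner_neg_right, ← hg]

/-! ### Invariance of the Gibbs law -/

/-- Reversal of the velocity. -/
def flip (z : State d) : State d := (z.1, -z.2)

theorem flip_flip (z : State d) : flip (flip z) = z := by simp [flip]

theorem measurable_flip : Measurable (flip : State d → State d) := by
  have h : Continuous (flip : State d → State d) := by unfold flip; fun_prop
  exact h.measurable

theorem flip_flow (t : ℝ) (z : State d) : flip (flow t (flip (flow t z))) = z := by
  refine Prod.ext ?_ ?_
  · change z.1 + toTorus (t • (z.2 : Space d)) + toTorus (t • -(z.2 : Space d)) = z.1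
    rw [add_assoc, ← toTorus_add, smul_neg, add_neg_cancel, toTorus_zero, add_zero]
  · exact neg_neg z.2

section

variable {U : Space d → ℝ} {r ε : ℝ}

theorem rate_reflect (x : Torus d) (y : UnitSphere d) :
    rate U ε (x, reflect U x y) = rate U ε (flip (x, y)) := by
  simp only [rate, flip]
  rw [inner_reflect_grad, ← inner_neg_left]
  rfl

theorem lintegral_flow [NeZero d] {f : State d → ℝ≥0∞} (hf : Measurable f) (t : ℝ) :
    ∫⁻ z, f (flow t z) ∂(volume : Measure (Torus d)).prod (uniformSphere d) =
      ∫⁻ z, f z ∂(volume : Measure (Torus d)).prod (uniformSphere d) := by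
  have hft : Measurable fun z => f (flow t z) := hf.comp (measurable_flow_right t)
  rw [lintegral_prod_symm _ hft.aemeasurable, lintegral_prod_symm _ hf.aemeasurable]
  refine lintegral_congr fun y => ?_
  exact lintegral_add_right_eq_self (fun x => f (x, y)) (toTorus (t • (y : Space d)))

/-- The density of the Gibbs law. -/
def gibbsDensity (U : Space d → ℝ) (ε : ℝ) (x : Torus d) : ℝ≥0∞ :=
  ENNReal.ofReal (Real.exp (-U (rep x) / ε) / ∫ x : Torus d, Real.exp (-U (rep x) / ε))

theorem lintegral_gibbs [NeZero d] (hU : Continuous U) {f : State d → ℝ≥0∞} (hf : Measurable f) :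
    ∫⁻ z, f z ∂gibbs U ε = ∫⁻ z, gibbsDensity U ε z.1 * f z
      ∂(volume : Measure (Torus d)).prod (uniformSphere d) := by
  have hw : Measurable (gibbsDensity U ε) :=
    ((((hU.measurable.comp measurable_rep).neg.div_const ε).exp).div_const _).ennreal_ofReal
  have hwf : Measurable fun z : State d => gibbsDensity U ε z.1 * f z :=
    (hw.comp measurable_fst).mul hf
  have : SFinite ((volume : Measure (Torus d)).tilted fun x => -U (rep x) / ε) := by
    unfold Measure.tilted; infer_instance
  rw [gibbs, lintegral_prod _ hf.aemeasurable, lintegral_tilted, lintegral_prod _ hwf.aemeasurable]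
  refine lintegral_congr fun x => ?_
  exact (lintegral_const_mul' _ _ ENNReal.ofReal_ne_top).symm

theorem isProbabilityMeasure_gibbs [NeZero d] (hU : Continuous U) : IsProbabilityMeasure (gibbs U ε) := by
  have hm : Measurable fun x : Torus d => Real.exp (-U (rep x) / ε) :=
    ((hU.measurable.comp measurable_rep).neg.div_const ε).exp
  have hint : Integrable (fun x : Torus d => Real.exp (-U (rep x) / ε)) := by
    obtain ⟨C, hC⟩ := exists_abs_rep_le hU
    refine Integrable.of_bound hm.aestronglyMeasurable (Real.exp (C / |ε|)) (ae_of_all _ fun x => ?_)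
    rw [Real.norm_eq_abs, Real.abs_exp, Real.exp_le_exp]
    refine (le_abs_self _).trans ?_
    rw [abs_div, abs_neg]
    exact div_le_div_of_nonneg_right (hC x) (abs_nonneg _)
  have := isProbabilityMeasure_tilted hint
  unfold gibbs
  infer_instance

variable (hU : ContDiff ℝ 1 U) (hper : IsPeriodic U)
include hU hper

/-- Since `a₊ - (-a)₊ = a`, the rates along a segment and along its reversal differ by `y · ∇U / ε`,
whose integral is the increment of `U / ε`. This is the detailed balance that selects the Gibbs
weight. -/
theorem cumRate_flip_flow (z : State d) (t : ℝ) :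
    cumRate U ε z t - cumRate U ε (flip (flow t z)) t =
      (U (rep (flow t z).1) - U (rep z.1)) / ε := by
  set v := rep z.1 with hv
  set y : Space d := (z.2 : Space d) with hy
  have hc : Continuous fun s : ℝ => inner ℝ y (gradient U (v + s • y)) := by
    have := continuous_gradient hU
    fun_prop
  have h1 : cumRate U ε z t = ∫ s in (0 : ℝ)..t, max (inner ℝ y (gradient U (v + s • y))) 0 / ε := by
    rw [cumRate]
    exact intervalIntegral.integral_congr fun s _ => rate_flow hper s z
  have h2 : cumRate U ε (flip (flow t z)) t =
      ∫ s in (0 : ℝ)..t, max (-inner ℝ y (gradient U (v + s • y))) 0 / ε := by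
    have h3 : ∀ s, rate U ε (flow s (flip (flow t z))) =
        max (-inner ℝ y (gradient U (v + (t - s) • y))) 0 / ε := fun s => by
      have h4 : (flow s (flip (flow t z))).1 = toTorus (v + (t - s) • y) := by
        rw [sub_smul, ← add_sub_assoc, sub_eq_add_neg, toTorus_add, toTorus_add, hv, toTorus_rep,
          ← smul_neg]
        rfl
      rw [rate, h4, hper.grad_toTorus, ← inner_neg_left]
      rfl
    rw [cumRate]
    simp_rw [h3]
    rw [intervalIntegral.integral_comp_sub_left
      (fun s => max (-inner ℝ y (gradient U (v + s • y))) 0 / ε)]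
    simp
  have h3 : (flow t z).1 = toTorus (v + t • y) := by rw [flow_eq]
  have hderiv : ∀ s, HasDerivAt (fun s : ℝ => U (v + s • y))
      (inner ℝ y (gradient U (v + s • y))) s := fun s => by
    have hd : DifferentiableAt ℝ U (v + s • y) := hU.differentiable one_ne_zero _
    have hl : HasDerivAt (fun s : ℝ => v + s • y) y s := by
      simpa using ((hasDerivAt_id s).smul_const y).const_add v
    have := hd.hasGradientAt.hasFDerivAt.comp_hasDerivAt s hl
    rw [InnerProductSpace.toDual_apply_apply, real_inner_comm] at this
    exact this
  rw [h1, h2, h3, hper.apply_rep, ← intervalIntegral.integral_sub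
    (Continuous.intervalIntegrable (by fun_prop) _ _)
    (Continuous.intervalIntegrable (by fun_prop) _ _)]
  have h5 : ∀ a : ℝ, max a 0 / ε - max (-a) 0 / ε = a / ε := fun a => by
    rw [← sub_div]
    congr 1
    rcases le_total 0 a with h | h
    · rw [max_eq_left h, max_eq_right (by linarith), sub_zero]
    · rw [max_eq_right h, max_eq_left (by linarith)]; ring
  simp_rw [h5]
  rw [intervalIntegral.integral_div, intervalIntegral.integral_eq_sub_of_hasDerivAt
    (fun s _ => hderiv s) (hc.intervalIntegrable _ _)]
  simp

variable [NeZero d]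

/-- The flow preserves Lebesgue × uniform. After this change of variables the Gibbs weight exactly
compensates the difference between forward and backward survival probabilities. -/
theorem lintegral_mul_killed {f g : State d → ℝ≥0∞} (hf : Measurable f) (hg : Measurable g)
    (t : ℝ) :
    ∫⁻ z, f z * killed U r ε t g z ∂gibbs U ε =
      ∫⁻ z, killed U r ε t (fun z => f (flip z)) (flip z) * g z ∂gibbs U ε := by
  have hw : Measurable (gibbsDensity U ε) :=
    ((((hU.continuous.measurable.comp measurable_rep).neg.div_const ε).exp).div_const
      _).ennreal_ofReal
  have hR : Measurable fun z => killed U r ε t (fun z => f (flip z)) (flip z) * g z :=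
    ((measurable_killed_right hU hper (hf.comp measurable_flip) t).comp measurable_flip).mul hg
  have hL : Measurable fun z => f z * killed U r ε t g z :=
    hf.mul (measurable_killed_right hU hper hg t)
  have hwR : Measurable fun z : State d => gibbsDensity U ε z.1 *
      (killed U r ε t (fun z => f (flip z)) (flip z) * g z) := (hw.comp measurable_fst).mul hR
  rw [lintegral_gibbs hU.continuous hL, lintegral_gibbs hU.continuous hR,
    ← lintegral_flow hwR t]
  refine lintegral_congr fun z => ?_
  rw [killed, killed, flip_flow, gibbsDensity, gibbsDensity]
  have hZ : 0 ≤ ∫ x : Torus d, Real.exp (-U (rep x) / ε) :=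
    integral_nonneg fun x => (Real.exp_pos _).le
  have hA := cumRate_flip_flow (ε := ε) hU hper z t
  have key : ENNReal.ofReal (Real.exp (-U (rep z.1) / ε) / ∫ x, Real.exp (-U (rep x) / ε)) *
      ENNReal.ofReal (Real.exp (-(cumRate U ε z t + r * t))) =
      ENNReal.ofReal (Real.exp (-U (rep (flow t z).1) / ε) / ∫ x, Real.exp (-U (rep x) / ε)) *
      ENNReal.ofReal (Real.exp (-(cumRate U ε (flip (flow t z)) t + r * t))) := by
    rw [← ENNReal.ofReal_mul (by positivity), ← ENNReal.ofReal_mul (by positivity),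
      div_mul_eq_mul_div, div_mul_eq_mul_div, ← Real.exp_add, ← Real.exp_add]
    congr 3
    rw [sub_div] at hA
    rw [neg_div, neg_div]
    linarith
  calc _ = ENNReal.ofReal (Real.exp (-U (rep z.1) / ε) / ∫ x, Real.exp (-U (rep x) / ε)) *
      ENNReal.ofReal (Real.exp (-(cumRate U ε z t + r * t))) * (f z * g (flow t z)) := by ring
    _ = _ := by rw [key]; ring

omit hper in
-- At a fixed position, the substitution `y ↦ y^*` preserves the uniform law and turns the rate at
-- `y` into the rate at `-y`. The refreshment part is symmetric, the uniform law being even.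
theorem lintegral_mul_jumpOp {f g : State d → ℝ≥0∞} (hf : Measurable f) (hg : Measurable g) :
    ∫⁻ z, f z * jumpOp U r ε g z ∂gibbs U ε =
      ∫⁻ z, jumpOp U r ε (fun z => f (flip z)) (flip z) * g z ∂gibbs U ε := by
  have hL : Measurable fun z => f z * jumpOp U r ε g z := hf.mul (measurable_jumpOp_right hU hg)
  have hR : Measurable fun z => jumpOp U r ε (fun z => f (flip z)) (flip z) * g z :=
    ((measurable_jumpOp_right hU (hf.comp measurable_flip)).comp measurable_flip).mul hg
  have : SFinite ((volume : Measure (Torus d)).tilted fun x => -U (rep x) / ε) := by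
    unfold Measure.tilted; infer_instance
  rw [gibbs, lintegral_prod _ hL.aemeasurable, lintegral_prod _ hR.aemeasurable]
  refine lintegral_congr fun x => ?_
  have hfx : Measurable fun y => f (x, y) := hf.comp measurable_prodMk_left
  have hgx : Measurable fun y => g (x, y) := hg.comp measurable_prodMk_left
  have hrefl := measurePreserving_reflect U x
  have hrate : Measurable fun y => ENNReal.ofReal (rate U ε (x, y)) :=
    ((measurable_rate hU).comp measurable_prodMk_left).ennreal_ofReal
  have h1 : ∫⁻ y, f (x, y) * (ENNReal.ofReal (rate U ε (x, y)) * g (x, reflect U x y))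
      ∂uniformSphere d = ∫⁻ y, ENNReal.ofReal (rate U ε (flip (x, y))) *
        f (x, reflect U x y) * g (x, y) ∂uniformSphere d := by
    have hm : Measurable fun y => f (x, y) * (ENNReal.ofReal (rate U ε (x, y)) *
        g (x, reflect U x y)) := hfx.mul (hrate.mul (hgx.comp hrefl.measurable))
    rw [← hrefl.lintegral_comp hm]
    refine lintegral_congr fun y => ?_
    rw [reflect_reflect, rate_reflect]
    ring
  have h2 : ∫⁻ v, f (flip (x, v)) ∂uniformSphere d = ∫⁻ v, f (x, v) ∂uniformSphere d :=
    measurePreserving_neg_uniformSphere.lintegral_comp hfx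
  have h3 : ∀ y, jumpOp U r ε (fun z => f (flip z)) (flip (x, y)) =
      ENNReal.ofReal (rate U ε (flip (x, y))) * f (x, reflect U x y) +
        ENNReal.ofReal r * ∫⁻ v, f (x, v) ∂uniformSphere d := fun y => by
    rw [jumpOp, ← h2]
    simp only [flip, reflect_neg, neg_neg]
  simp_rw [h3, jumpOp, mul_add, add_mul]
  have hm1 : Measurable fun y => f (x, y) * (ENNReal.ofReal (rate U ε (x, y)) *
      g (x, reflect U x y)) := hfx.mul (hrate.mul (hgx.comp hrefl.measurable))
  have hm2 : Measurable fun y => ENNReal.ofReal (rate U ε (flip (x, y))) *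
      f (x, reflect U x y) * g (x, y) :=
    ((hrate.comp measurePreserving_neg_uniformSphere.measurable).mul
      (hfx.comp hrefl.measurable)).mul hgx
  rw [lintegral_add_left hm1, lintegral_add_left hm2, h1, lintegral_mul_const _ hfx,
    lintegral_const_mul _ hgx]
  ring

/-- Trajectories with `n` jumps are read backwards: the first jump on the side of `g` becomes the
last jump on the side of `f`. Hence one side uses the definition and the other `dyson_succ'`. -/
theorem lintegral_mul_dyson {f g : State d → ℝ≥0∞} (hf : Measurable f) (hg : Measurable g)
    (n : ℕ) (t : ℝ) :
    ∫⁻ z, f z * dyson U r ε n g t z ∂gibbs U ε =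
      ∫⁻ z, dyson U r ε n (fun z => f (flip z)) t (flip z) * g z ∂gibbs U ε := by
  have := isProbabilityMeasure_gibbs (ε := ε) hU.continuous
  induction n generalizing f t with
  | zero =>
    simp only [dyson_zero, noJump]
    split_ifs
    · exact lintegral_mul_killed hU hper hf hg t
    · simp
  | succ n ih =>
    have hff : Measurable fun z => f (flip z) := hf.comp measurable_flip
    have hdy := measurable_dyson (r := r) (ε := ε) hU hper hg n
    have hjd : Measurable (Function.uncurry fun u => jumpOp U r ε (dyson U r ε n g u)) :=
      measurable_jumpOp (g := dyson U r ε n g) hU hdy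
    have hm1 : Measurable fun p : State d × ℝ =>
        killed U r ε p.2 (jumpOp U r ε (dyson U r ε n g (t - p.2))) p.1 := by
      have h1 := measurable_killed (r := r) (ε := ε) hU hper hjd
      have h2 : Measurable fun p : State d × ℝ => ((p.2, t - p.2), p.1) := by fun_prop
      exact h1.comp h2
    have hjk : Measurable (Function.uncurry fun s =>
        jumpOp U r ε (killed U r ε s fun z => f (flip z))) := measurable_jumpOp hU (measurable_killed_time hU hper hff)
    have hm2 : Measurable fun p : State d × ℝ => dyson U r ε n
        (jumpOp U r ε (killed U r ε p.2 fun z => f (flip z))) (t - p.2) (flip p.1) := by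
      have h1 := measurable_dyson_param (r := r) (ε := ε) hU hper hjk n
      have h2 : Measurable fun p : State d × ℝ => (p.2, t - p.2, flip p.1) :=
        measurable_snd.prodMk ((measurable_snd.const_sub t).prodMk
          (measurable_flip.comp measurable_fst))
      exact h1.comp h2
    have hL : ∀ z, f z * dyson U r ε (n + 1) g t z = ∫⁻ s in Set.Ioi 0,
        f z * killed U r ε s (jumpOp U r ε (dyson U r ε n g (t - s))) z := fun z => by
      rw [dyson_succ, step, lintegral_const_mul]
      exact hm1.comp measurable_prodMk_left
    have hR : ∀ z, dyson U r ε (n + 1) (fun z => f (flip z)) t (flip z) * g z =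
        ∫⁻ s in Set.Ioi 0, dyson U r ε n
          (jumpOp U r ε (killed U r ε s fun z => f (flip z))) (t - s) (flip z) * g z := fun z => by
      rw [dyson_succ' hU hper hff, lintegral_mul_const]
      exact hm2.comp measurable_prodMk_left
    simp_rw [hL, hR]
    have hm1' : Measurable fun p : State d × ℝ =>
        f p.1 * killed U r ε p.2 (jumpOp U r ε (dyson U r ε n g (t - p.2))) p.1 :=
      (hf.comp measurable_fst).mul hm1
    have hm2' : Measurable fun p : State d × ℝ => dyson U r ε n
        (jumpOp U r ε (killed U r ε p.2 fun z => f (flip z))) (t - p.2) (flip p.1) * g p.1 :=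
      hm2.mul (hg.comp measurable_fst)
    rw [lintegral_lintegral_swap (f := fun z s => f z * killed U r ε s (jumpOp U r ε
        (dyson U r ε n g (t - s))) z) hm1'.aemeasurable,
      lintegral_lintegral_swap (f := fun z s => dyson U r ε n
        (jumpOp U r ε (killed U r ε s fun z => f (flip z))) (t - s) (flip z) * g z)
        hm2'.aemeasurable]
    refine lintegral_congr fun s => ?_
    have hd : Measurable (dyson U r ε n g (t - s)) := measurable_dyson_right hU hper hg n _
    have hkf : Measurable fun z => killed U r ε s (fun z => f (flip z)) (flip z) :=
      (measurable_killed_right hU hper hff s).comp measurable_flip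
    have hjf : Measurable fun z => jumpOp U r ε (killed U r ε s fun z => f (flip z)) (flip z) :=
      (measurable_jumpOp_right hU (measurable_killed_right hU hper hff s)).comp measurable_flip
    rw [lintegral_mul_killed hU hper hf (measurable_jumpOp_right hU hd), lintegral_mul_jumpOp hU hkf hd]
    simp only [flip_flip]
    rw [ih hjf]
    simp only [flip_flip]

theorem semigroup_one (hr : 0 < r) (hε : 0 < ε) {t : ℝ} (ht : 0 ≤ t) (z : State d) :
    semigroup U r ε t (fun _ => 1) z = 1 := by
  rw [← lintegral_process hU hper hr hε measurable_const ht]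
  simp

theorem lintegral_semigroup_gibbs (hr : 0 < r) (hε : 0 < ε) {g : State d → ℝ≥0∞}
    (hg : Measurable g) {t : ℝ} (ht : 0 ≤ t) :
    ∫⁻ z, semigroup U r ε t g z ∂gibbs U ε = ∫⁻ z, g z ∂gibbs U ε := by
  have h1 : ∀ n, ∫⁻ z, dyson U r ε n g t z ∂gibbs U ε =
      ∫⁻ z, dyson U r ε n (fun _ => 1) t (flip z) * g z ∂gibbs U ε := fun n => by
    simpa only [one_mul] using
      lintegral_mul_dyson (r := r) hU hper (f := fun _ => 1) measurable_const hg n t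
  simp_rw [semigroup]
  rw [lintegral_tsum fun n => (measurable_dyson_right hU hper hg n t).aemeasurable]
  simp_rw [h1]
  have hm : ∀ n, Measurable fun z => dyson U r ε n (fun _ => 1) t (flip z) * g z := fun n =>
    ((measurable_dyson_right hU hper measurable_const n t).comp measurable_flip).mul hg
  rw [← lintegral_tsum fun n => (hm n).aemeasurable]
  refine lintegral_congr fun z => ?_
  rw [ENNReal.tsum_mul_right]
  have := semigroup_one hU hper hr hε ht (flip z)
  rw [semigroup] at this
  rw [this, one_mul]

theorem law_gibbs (hr : 0 < r) (hε : 0 < ε) {t : ℝ} (ht : 0 ≤ t) :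
    law U r ε (gibbs U ε) t = gibbs U ε := by
  have := isProbabilityMeasure_gibbs (ε := ε) hU.continuous
  refine Measure.ext_of_lintegral _ fun f hf => ?_
  rw [lintegral_law hU hper hr hε hf ht, lintegral_semigroup_gibbs hU hper hr hε hf ht]

theorem law_law (hr : 0 < r) (hε : 0 < ε) {s t : ℝ} (hs : 0 ≤ s) (ht : 0 ≤ t)
    (μ : Measure (State d)) [IsFiniteMeasure μ] :
    law U r ε (law U r ε μ s) t = law U r ε μ (s + t) := by
  have : IsFiniteMeasure (law U r ε μ s) := by unfold law; infer_instance
  refine Measure.ext_of_lintegral _ fun f hf => ?_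
  rw [lintegral_law hU hper hr hε hf ht, lintegral_law hU hper hr hε
    (measurable_semigroup hU hper hf t) hs, lintegral_law hU hper hr hε hf (add_nonneg hs ht)]
  exact lintegral_congr fun z => (semigroup_add hU hper hf ht hs z).symm

end

/-! ### Polar coordinates and broken lines of given length -/

theorem lintegral_volumeIoiPow (n : ℕ) {g : ℝ → ℝ≥0∞} (hg : Measurable g) :
    ∫⁻ s, g s ∂Measure.volumeIoiPow n = ∫⁻ s in Set.Ioi 0, ENNReal.ofReal (s ^ n) * g s := by
  have hm : Measurable fun s : Set.Ioi (0 : ℝ) => ENNReal.ofReal ((s : ℝ) ^ n) := by fun_prop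
  have hgm : Measurable fun s : Set.Ioi (0 : ℝ) => g s := hg.comp measurable_subtype_coe
  rw [Measure.volumeIoiPow, lintegral_withDensity_eq_lintegral_mul _ hm hgm,
    ← lintegral_subtype_comap measurableSet_Ioi]
  rfl

theorem lintegral_polar [NeZero d] {F : Space d → ℝ≥0∞} (hF : Measurable F) :
    ∫⁻ u, F u = ∫⁻ σ, (∫⁻ s in Set.Ioi 0, ENNReal.ofReal (s ^ (d - 1)) * F (s • (σ : Space d)))
      ∂(volume : Measure (Space d)).toSphere := by
  have hmp := Measure.measurePreserving_homeomorphUnitSphereProd (volume : Measure (Space d))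
  rw [finrank_euclideanSpace_fin] at hmp
  have hm : Measurable fun p : UnitSphere d × Set.Ioi (0 : ℝ) =>
      F ((p.2 : ℝ) • (p.1 : Space d)) := hF.comp (by fun_prop)
  have h1 : ∫⁻ u, F u = ∫⁻ u : ({0}ᶜ : Set (Space d)), F u ∂Measure.comap Subtype.val volume := by
    rw [lintegral_subtype_comap (measurableSet_singleton 0).compl, restrict_compl_singleton]
  have h2 := hmp.lintegral_comp hm
  have h3 : ∀ u : ({0}ᶜ : Set (Space d)),
      (((homeomorphUnitSphereProd (Space d)) u).2 : ℝ) •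
        (((homeomorphUnitSphereProd (Space d)) u).1 : Space d) = u := fun u => by
    have := congrArg Subtype.val ((homeomorphUnitSphereProd (Space d)).symm_apply_apply u)
    exact this
  simp_rw [h3] at h2
  rw [h1, h2, lintegral_prod _ hm.aemeasurable]
  refine lintegral_congr fun σ => ?_
  exact lintegral_volumeIoiPow (d - 1) (g := fun s => F (s • (σ : Space d)))
    (hF.comp (by fun_prop))

/-- Lebesgue measure is a multiple of the `d`-dimensional Hausdorff measure, for which the bound is
immediate; the multiple cancels. -/
theorem volume_image_le_of_lipschitz {φ : Space d → Space d} {C : NNReal} (hφ : LipschitzWith C φ)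
    (S : Set (Space d)) : volume (φ '' S) ≤ (C : ℝ≥0∞) ^ d * volume S := by
  have hH : (Measure.hausdorffMeasure (Module.finrank ℝ (Space d)) :
      Measure (Space d)).IsAddHaarMeasure := isAddHaarMeasure_hausdorffMeasure
  have hvol := Measure.isAddLeftInvariant_eq_smul (volume : Measure (Space d))
    (Measure.hausdorffMeasure (Module.finrank ℝ (Space d)))
  have h := hφ.hausdorffMeasure_image_le (d := Module.finrank ℝ (Space d)) (by positivity) S
  rw [hvol]
  simp only [Measure.smul_apply, ENNReal.smul_def, smul_eq_mul]
  calc _ ≤ _ := mul_le_mul_right h _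
    _ = _ := by
      rw [ENNReal.rpow_natCast, mul_left_comm]
      simp only [finrank_euclideanSpace_fin]

/-- The end point of a broken line of length `τ`, with the first segment `u` and the second one
in the direction `w`. -/
def brokenLine (τ : ℝ) (w u : Space d) : Space d := u + (τ - ‖u‖) • w

theorem lipschitzWith_brokenLine (τ : ℝ) {w : Space d} (hw : ‖w‖ = 1) :
    LipschitzWith 2 (brokenLine τ w) := by
  refine LipschitzWith.of_dist_le_mul fun u v => ?_
  have h : brokenLine τ w u - brokenLine τ w v = (u - v) + (‖v‖ - ‖u‖) • w := by
    simp only [brokenLine]; module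
  rw [dist_eq_norm, dist_eq_norm, h]
  have h1 := norm_add_le (u - v) ((‖v‖ - ‖u‖) • w)
  rw [norm_smul, hw, mul_one, Real.norm_eq_abs] at h1
  have h2 := abs_norm_sub_norm_le v u
  rw [norm_sub_rev v u] at h2
  push_cast
  linarith

theorem ball_subset_image_brokenLine (τ : ℝ) (w : Space d) :
    Metric.ball (0 : Space d) τ ⊆ brokenLine τ w '' Metric.ball 0 τ := by
  intro p hp
  rw [mem_ball_zero_iff] at hp
  have hτ : 0 ≤ τ := (norm_nonneg p).trans hp.le
  -- The length `ρ` of the first segment must equal `|p - (τ - ρ) w|`. The difference is nonnegative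
  -- at `ρ = 0` and negative at `ρ = τ`, so it vanishes in between.
  have hc : ContinuousOn (fun ρ : ℝ => ‖p - (τ - ρ) • w‖ - ρ) (Set.Icc 0 τ) := by fun_prop
  obtain ⟨ρ, hρ, h⟩ := intermediate_value_Icc' hτ hc (show (0 : ℝ) ∈ Set.Icc _ _ by
    simp only [sub_self, zero_smul, sub_zero]
    exact ⟨by linarith, norm_nonneg _⟩)
  have h0 : ‖p - (τ - ρ) • w‖ = ρ := by simpa [sub_eq_zero] using h
  refine ⟨p - (τ - ρ) • w, ?_, ?_⟩
  · rw [mem_ball_zero_iff, h0]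
    refine lt_of_le_of_ne hρ.2 fun h1 => ?_
    rw [h1] at h0
    simp only [sub_self, zero_smul, sub_zero] at h0
    linarith
  · rw [brokenLine, h0]; abel

/-- Being 2-Lipschitz and covering the ball, the map pushes the measure on the ball to one that
dominates it up to `2^d`. No injectivity or Jacobian is needed. -/
theorem setLIntegral_ball_le_brokenLine {τ : ℝ} {w : Space d} (hw : ‖w‖ = 1)
    {G : Space d → ℝ≥0∞} (hG : Measurable G) :
    ((2 : ℝ≥0∞) ^ d)⁻¹ * ∫⁻ p in Metric.ball 0 τ, G p ≤
      ∫⁻ u in Metric.ball 0 τ, G (brokenLine τ w u) := by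
  have hφ := lipschitzWith_brokenLine τ hw
  have hm : Measurable (brokenLine τ w) := hφ.continuous.measurable
  have hle : ((2 : ℝ≥0∞) ^ d)⁻¹ • volume.restrict (Metric.ball (0 : Space d) τ) ≤
      (volume.restrict (Metric.ball (0 : Space d) τ)).map (brokenLine τ w) := by
    refine Measure.le_intro fun A hA _ => ?_
    rw [Measure.map_apply hm hA, Measure.smul_apply, Measure.restrict_apply hA,
      Measure.restrict_apply (hm hA), smul_eq_mul,
      ENNReal.inv_mul_le_iff (by simp) (by simp)]
    refine le_trans (measure_mono ?_) (volume_image_le_of_lipschitz hφ _)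
    rintro p ⟨hpA, hp⟩
    obtain ⟨u, hu, rfl⟩ := ball_subset_image_brokenLine τ w hp
    exact ⟨u, ⟨hpA, hu⟩, rfl⟩
  rw [← lintegral_map hG hm]
  refine le_trans ?_ (lintegral_mono' hle le_rfl)
  rw [lintegral_smul_measure, smul_eq_mul]

theorem exists_mul_setLIntegral_ball_le [NeZero d] {R : ℝ} (hR : 0 < R) :
    ∃ κ : ℝ, 0 < κ ∧ ∀ (τ : ℝ) (w : UnitSphere d) (G : Space d → ℝ≥0∞), τ ≤ R → Measurable G →
      ENNReal.ofReal κ * ∫⁻ p in Metric.ball 0 τ, G p ≤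
        ∫⁻ v, (∫⁻ s in Set.Ioc 0 τ, G (s • (v : Space d) + (τ - s) • (w : Space d)))
          ∂uniformSphere d := by
  set m := (volume : Measure (Space d)).toSphere Set.univ with hm
  have hm0 : m ≠ 0 := by
    rw [hm, Measure.measure_univ_ne_zero]; exact Measure.toSphere_ne_zero _
  have hmt : m ≠ ⊤ := measure_ne_top _ _
  have hκ0 : m⁻¹ * ((ENNReal.ofReal (R ^ (d - 1)))⁻¹ * ((2 : ℝ≥0∞) ^ d)⁻¹) ≠ 0 := by
    simp [hmt]
  have hκt : m⁻¹ * ((ENNReal.ofReal (R ^ (d - 1)))⁻¹ * ((2 : ℝ≥0∞) ^ d)⁻¹) ≠ ⊤ := by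
    refine ENNReal.mul_ne_top (ENNReal.inv_ne_top.2 hm0) (ENNReal.mul_ne_top
      (ENNReal.inv_ne_top.2 ?_) (ENNReal.inv_ne_top.2 (by simp)))
    simpa using pow_pos hR _
  -- The factors come from normalizing the surface measure, from `s^(d-1) ≤ R^(d-1)` in polar
  -- coordinates, and from the Lipschitz bound.
  refine ⟨(m⁻¹ * ((ENNReal.ofReal (R ^ (d - 1)))⁻¹ * ((2 : ℝ≥0∞) ^ d)⁻¹)).toReal,
    ENNReal.toReal_pos hκ0 hκt, fun τ w G hτ hG => ?_⟩
  have hφ : Measurable (brokenLine τ (w : Space d)) :=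
    (lipschitzWith_brokenLine τ (norm_velocity w)).continuous.measurable
  have hH : Measurable fun u => (Metric.ball (0 : Space d) τ).indicator
      (fun u => G (brokenLine τ (w : Space d) u)) u :=
    (hG.comp hφ).indicator measurableSet_ball
  rw [ENNReal.ofReal_toReal hκt, mul_assoc, mul_assoc, uniformSphere, lintegral_smul_measure,
    smul_eq_mul]
  refine mul_le_mul_right ?_ _
  rw [ENNReal.inv_mul_le_iff (by simpa using pow_pos hR _) ENNReal.ofReal_ne_top]
  refine (setLIntegral_ball_le_brokenLine (norm_velocity w) hG).trans ?_
  rw [← lintegral_indicator measurableSet_ball, lintegral_polar hH,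
    ← lintegral_const_mul' _ _ ENNReal.ofReal_ne_top]
  refine lintegral_mono fun σ => ?_
  rw [← lintegral_const_mul' _ _ ENNReal.ofReal_ne_top, ← lintegral_indicator measurableSet_Ioi,
    ← lintegral_indicator measurableSet_Ioc]
  refine lintegral_mono fun s => ?_
  by_cases hs : 0 < s
  · have hnorm : ‖s • (σ : Space d)‖ = s := by
      rw [norm_smul, norm_velocity, mul_one, Real.norm_of_nonneg hs.le]
    rw [Set.indicator_of_mem (by exact hs)]
    by_cases hsτ : s < τ
    · rw [Set.indicator_of_mem (by rw [mem_ball_zero_iff, hnorm]; exact hsτ),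
        Set.indicator_of_mem (by exact ⟨hs, hsτ.le⟩), brokenLine, hnorm]
      exact mul_le_mul_left (ENNReal.ofReal_le_ofReal
        (pow_le_pow_left₀ hs.le (hsτ.le.trans hτ) _)) _
    · rw [Set.indicator_of_notMem (by rw [mem_ball_zero_iff, hnorm]; exact hsτ), mul_zero]
      exact zero_le
  · rw [Set.indicator_of_notMem (by exact hs)]
    exact zero_le

theorem lintegral_torus_le_setLIntegral_ball [NeZero d] {τ : ℝ} (hτ : Real.sqrt d / 2 < τ)
    {h : Torus d → ℝ≥0∞} (hh : Measurable h) (x : Torus d) :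
    ∫⁻ x, h x ≤ ∫⁻ p in Metric.ball (0 : Space d) τ, h (x + toTorus p) := by
  -- The centred unit cube is a fundamental domain and lies within distance `√d / 2` of the origin.
  set Q : Set (Fin d → ℝ) := Set.univ.pi fun _ => Set.Ioc (-1 / 2 : ℝ) (-1 / 2 + 1) with hQ
  have hmp : MeasurePreserving (fun p : Fin d → ℝ => fun i => ((p i : ℝ) : UnitAddCircle))
      (volume.restrict Q) volume := by
    rw [hQ, volume_pi, Measure.restrict_pi_pi]
    exact measurePreserving_pi _ _ fun _ => UnitAddCircle.measurePreserving_mk _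
  have hQm : MeasurableSet Q := MeasurableSet.univ_pi fun _ => measurableSet_Ioc
  have hof := PiLp.volume_preserving_ofLp (Fin d)
  have hball : (WithLp.ofLp : Space d → Fin d → ℝ) ⁻¹' Q ⊆ Metric.ball 0 τ := by
    intro p hp
    rw [mem_ball_zero_iff]
    refine lt_of_le_of_lt ?_ hτ
    rw [EuclideanSpace.norm_eq]
    have h1 : ∀ i, ‖p i‖ ^ 2 ≤ 1 / 4 := fun i => by
      have hi : p i ∈ Set.Ioc (-1 / 2 : ℝ) (-1 / 2 + 1) := hp i (Set.mem_univ i)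
      have h2 := hi.1
      have h3 := hi.2
      rw [Real.norm_eq_abs, sq_abs]
      nlinarith
    have h4 : ∑ i, ‖p i‖ ^ 2 ≤ d / 4 := by
      calc ∑ i, ‖p i‖ ^ 2 ≤ ∑ _i : Fin d, (1 / 4 : ℝ) := Finset.sum_le_sum fun i _ => h1 i
        _ = d / 4 := by simp; ring
    calc Real.sqrt (∑ i, ‖p i‖ ^ 2) ≤ Real.sqrt (d / 4) := Real.sqrt_le_sqrt h4
      _ = Real.sqrt d / 2 := by
        rw [Real.sqrt_div (by positivity), show (4 : ℝ) = 2 ^ 2 by norm_num,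
          Real.sqrt_sq (by norm_num)]
  have hhx : Measurable fun y => h (x + y) := hh.comp (measurable_const_add x)
  calc ∫⁻ y, h y = ∫⁻ y, h (x + y) := (lintegral_add_left_eq_self h x).symm
    _ = ∫⁻ p in Q, h (x + fun i => ((p i : ℝ) : UnitAddCircle)) := (hmp.lintegral_comp hhx).symm
    _ = ∫⁻ p in (WithLp.ofLp : Space d → Fin d → ℝ) ⁻¹' Q, h (x + toTorus p) :=
      ((hof.restrict_preimage hQm).lintegral_comp (hhx.comp hmp.measurable)).symm
    _ ≤ _ := lintegral_mono_set hball

theorem lintegral_brokenLine_swap [NeZero d] (τ : ℝ) {G : Space d → UnitSphere d → ℝ≥0∞}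
    (hG : Measurable (Function.uncurry G)) :
    ∫⁻ v₁, (∫⁻ s in Set.Ioc 0 τ, ∫⁻ v, G (s • (v₁ : Space d) + (τ - s) • (v : Space d)) v
      ∂uniformSphere d) ∂uniformSphere d =
    ∫⁻ v, ∫⁻ v₁, (∫⁻ s in Set.Ioc 0 τ, G (s • (v₁ : Space d) + (τ - s) • (v : Space d)) v)
      ∂uniformSphere d ∂uniformSphere d := by
  have h0 : Measurable fun q : (UnitSphere d × ℝ) × UnitSphere d =>
      (q.1.2 • (q.1.1 : Space d) + (τ - q.1.2) • (q.2 : Space d), q.2) := by fun_prop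
  have hm := hG.comp h0
  have hswap : ∀ v₁ : UnitSphere d, ∫⁻ s in Set.Ioc 0 τ, ∫⁻ v,
      G (s • (v₁ : Space d) + (τ - s) • (v : Space d)) v ∂uniformSphere d =
      ∫⁻ v, (∫⁻ s in Set.Ioc 0 τ, G (s • (v₁ : Space d) + (τ - s) • (v : Space d)) v)
        ∂uniformSphere d := fun v₁ => by
    have h2 : Measurable fun q : ℝ × UnitSphere d => ((v₁, q.1), q.2) := by fun_prop
    have h3 : Measurable (Function.uncurry fun (s : ℝ) (v : UnitSphere d) =>
        G (s • (v₁ : Space d) + (τ - s) • (v : Space d)) v) := hm.comp h2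
    exact lintegral_lintegral_swap h3.aemeasurable
  simp_rw [hswap]
  have h4 : Measurable (Function.uncurry fun (v₁ v : UnitSphere d) =>
      ∫⁻ s in Set.Ioc 0 τ, G (s • (v₁ : Space d) + (τ - s) • (v : Space d)) v) := by
    have h5 : Measurable fun q : (UnitSphere d × UnitSphere d) × ℝ =>
        ((q.1.1, q.2), q.1.2) := by fun_prop
    exact (hm.comp h5).lintegral_prod_right'
  exact lintegral_lintegral_swap h4.aemeasurable

/-- For each fixed final velocity `v`, the first segment `s₁ v₁` alone spreads the position over the
whole torus. -/
theorem exists_mul_lintegral_torus_le [NeZero d] :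
    ∃ κ : ℝ, 0 < κ ∧ ∀ (τ : ℝ) (x : Torus d) (f : State d → ℝ≥0∞), Measurable f →
      Real.sqrt d / 2 < τ → τ ≤ Real.sqrt d →
        ENNReal.ofReal κ * ∫⁻ z, f z ∂(volume : Measure (Torus d)).prod (uniformSphere d) ≤
          ∫⁻ v₁, (∫⁻ s₁ in Set.Ioc 0 τ, ∫⁻ v,
            f (x + toTorus (s₁ • (v₁ : Space d) + (τ - s₁) • (v : Space d)), v)
              ∂uniformSphere d) ∂uniformSphere d := by
  have hd : 0 < Real.sqrt d := Real.sqrt_pos.2 (Nat.cast_pos.2 (NeZero.pos d))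
  obtain ⟨κ, hκ0, hκ⟩ := exists_mul_setLIntegral_ball_le (d := d) hd
  refine ⟨κ, hκ0, fun τ x f hf hτ1 hτ2 => ?_⟩
  have hx : Measurable fun p : Space d => x + toTorus p :=
    continuous_toTorus.measurable.const_add x
  have hG : Measurable (Function.uncurry fun (p : Space d) (v : UnitSphere d) =>
      f (x + toTorus p, v)) := hf.comp ((hx.comp measurable_fst).prodMk measurable_snd)
  rw [lintegral_brokenLine_swap τ hG, lintegral_prod_symm _ hf.aemeasurable,
    ← lintegral_const_mul' _ _ ENNReal.ofReal_ne_top]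
  refine lintegral_mono fun v => ?_
  have hfv : Measurable fun x => f (x, v) := hf.comp measurable_prodMk_right
  refine le_trans (mul_le_mul_right
    (lintegral_torus_le_setLIntegral_ball hτ1 hfv x) _) ?_
  exact hκ τ v (fun p => f (x + toTorus p, v)) hτ2 (hfv.comp hx)

/-! ### Minorization -/

section

variable {U : Space d → ℝ} {r ε : ℝ} (hU : ContDiff ℝ 1 U) (hper : IsPeriodic U)
include hU hper

theorem le_killed {M : ℝ} (hM : ∀ x, ‖grad U x‖ ≤ M) (hε : 0 < ε) {t : ℝ} (ht : 0 ≤ t)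
    (g : State d → ℝ≥0∞) (z : State d) :
    ENNReal.ofReal (Real.exp (-((M / ε + r) * t))) * g (flow t z) ≤ killed U r ε t g z := by
  rw [killed]
  refine mul_le_mul_left (ENNReal.ofReal_le_ofReal (Real.exp_le_exp.2 (neg_le_neg ?_))) _
  have := cumRate_le hU hper hM hε z ht
  linarith

omit hU hper in
theorem le_jumpOp (g : State d → ℝ≥0∞) (z : State d) :
    ENNReal.ofReal r * ∫⁻ v, g (z.1, v) ∂uniformSphere d ≤ jumpOp U r ε g z := by
  rw [jumpOp]; exact le_add_self

/-- Only refreshments are kept. The survival factors of the successive segments multiply to that of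
the total time. -/
theorem le_dyson_one {M : ℝ} (hM : ∀ x, ‖grad U x‖ ≤ M) (hr : 0 < r) (hε : 0 < ε)
    (f : State d → ℝ≥0∞) (t : ℝ) (z : State d) :
    ENNReal.ofReal (r * Real.exp (-((M / ε + r) * t))) * ∫⁻ s in Set.Ioc 0 t, ∫⁻ v,
      f (z.1 + toTorus (s • (z.2 : Space d) + (t - s) • (v : Space d)), v) ∂uniformSphere d ≤
      dyson U r ε 1 f t z := by
  rw [dyson_succ_eq_setLIntegral, ← lintegral_const_mul' _ _ ENNReal.ofReal_ne_top]
  refine setLIntegral_mono' measurableSet_Ioc fun s hs => ?_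
  refine le_trans ?_ (le_killed hU hper hM hε hs.1.le _ z)
  refine le_trans ?_ (mul_le_mul_right (le_jumpOp _ _) _)
  have h1 : ∀ v : UnitSphere d, ENNReal.ofReal (Real.exp (-((M / ε + r) * (t - s)))) *
      f (z.1 + toTorus (s • (z.2 : Space d) + (t - s) • (v : Space d)), v) ≤
        dyson U r ε 0 f (t - s) ((flow s z).1, v) := fun v => by
    rw [dyson_zero, noJump, if_pos (sub_nonneg.2 hs.2)]
    refine le_trans (le_of_eq ?_) (le_killed hU hper hM hε (sub_nonneg.2 hs.2) _ _)
    rw [toTorus_add, ← add_assoc]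
    rfl
  refine le_trans ?_ (mul_le_mul_right (mul_le_mul_right (lintegral_mono h1) _) _)
  rw [lintegral_const_mul' _ _ ENNReal.ofReal_ne_top, ← mul_assoc, ← mul_assoc,
    ← ENNReal.ofReal_mul (Real.exp_pos _).le, ← ENNReal.ofReal_mul (by positivity)]
  refine mul_le_mul_left (ENNReal.ofReal_le_ofReal (le_of_eq ?_)) _
  rw [mul_comm (Real.exp _) r, mul_assoc, ← Real.exp_add]
  ring_nf

theorem le_dyson_two {M : ℝ} (hM : ∀ x, ‖grad U x‖ ≤ M) (hr : 0 < r) (hε : 0 < ε)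
    (f : State d → ℝ≥0∞) (t : ℝ) (z : State d) :
    ENNReal.ofReal (r ^ 2 * Real.exp (-((M / ε + r) * t))) * ∫⁻ s in Set.Ioc 0 t, ∫⁻ v₁,
      (∫⁻ s₁ in Set.Ioc 0 (t - s), ∫⁻ v, f ((flow s z).1 + toTorus (s₁ • (v₁ : Space d) +
        (t - s - s₁) • (v : Space d)), v) ∂uniformSphere d) ∂uniformSphere d ≤
      dyson U r ε 2 f t z := by
  rw [dyson_succ_eq_setLIntegral, ← lintegral_const_mul' _ _ ENNReal.ofReal_ne_top]
  refine setLIntegral_mono' measurableSet_Ioc fun s hs => ?_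
  refine le_trans ?_ (le_killed hU hper hM hε hs.1.le _ z)
  refine le_trans ?_ (mul_le_mul_right (le_jumpOp _ _) _)
  refine le_trans ?_ (mul_le_mul_right (mul_le_mul_right (lintegral_mono fun v₁ =>
    le_dyson_one hU hper hM hr hε f (t - s) ((flow s z).1, v₁)) _) _)
  rw [lintegral_const_mul' _ _ ENNReal.ofReal_ne_top, ← mul_assoc, ← mul_assoc,
    ← ENNReal.ofReal_mul (Real.exp_pos _).le, ← ENNReal.ofReal_mul (by positivity)]
  refine mul_le_mul_left (ENNReal.ofReal_le_ofReal (le_of_eq ?_)) _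
  calc r ^ 2 * Real.exp (-((M / ε + r) * t)) = r ^ 2 * (Real.exp (-((M / ε + r) * s)) *
        Real.exp (-((M / ε + r) * (t - s)))) := by rw [← Real.exp_add]; ring_nf
    _ = _ := by ring

/-- The first refreshment removes the dependence on the initial velocity, the second one makes the
final velocity uniform. -/
theorem exists_minorization [NeZero d] {M : ℝ} (hM : ∀ x, ‖grad U x‖ ≤ M) (hr : 0 < r) :
    ∃ a : ℝ, 0 < a ∧ ∀ ε, 0 < ε → ∀ (f : State d → ℝ≥0∞), Measurable f → ∀ z,
      ENNReal.ofReal (a * Real.exp (-((M / ε + r) * Real.sqrt d))) *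
        ∫⁻ z, f z ∂(volume : Measure (Torus d)).prod (uniformSphere d) ≤
          semigroup U r ε (Real.sqrt d) f z := by
  have hd : 0 < Real.sqrt d := Real.sqrt_pos.2 (Nat.cast_pos.2 (NeZero.pos d))
  obtain ⟨κ, hκ0, hκ⟩ := exists_mul_lintegral_torus_le (d := d)
  refine ⟨r ^ 2 * (κ * (Real.sqrt d / 2)), by positivity, fun ε hε f hf z => ?_⟩
  refine le_trans ?_ (ENNReal.le_tsum 2)
  refine le_trans ?_ (le_dyson_two hU hper hM hr hε f _ z)
  set I := ∫⁻ z, f z ∂(volume : Measure (Torus d)).prod (uniformSphere d) with hI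
  -- A first refreshment before `√d / 2` leaves a time `τ > √d / 2` for the broken line. Integrating
  -- over such `s` gives the factor `√d / 2` in `a`.
  have hs : ∀ s ∈ Set.Ioo 0 (Real.sqrt d / 2), ENNReal.ofReal κ * I ≤ ∫⁻ v₁,
      (∫⁻ s₁ in Set.Ioc 0 (Real.sqrt d - s), ∫⁻ v, f ((flow s z).1 +
        toTorus (s₁ • (v₁ : Space d) + (Real.sqrt d - s - s₁) • (v : Space d)), v)
          ∂uniformSphere d) ∂uniformSphere d := fun s hs => by
    refine hκ _ _ f hf ?_ ?_
    · have := hs.2; linarith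
    · have := hs.1; linarith
  have hsub : Set.Ioo 0 (Real.sqrt d / 2) ⊆ Set.Ioc 0 (Real.sqrt d) := fun s hs =>
    ⟨hs.1, by have := hs.2; linarith⟩
  have hlow : ENNReal.ofReal κ * I * ENNReal.ofReal (Real.sqrt d / 2) ≤
      ∫⁻ s in Set.Ioc 0 (Real.sqrt d), ∫⁻ v₁, (∫⁻ s₁ in Set.Ioc 0 (Real.sqrt d - s), ∫⁻ v,
        f ((flow s z).1 + toTorus (s₁ • (v₁ : Space d) +
          (Real.sqrt d - s - s₁) • (v : Space d)), v) ∂uniformSphere d) ∂uniformSphere d := by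
    refine le_trans ?_ (lintegral_mono_set hsub)
    refine le_trans (le_of_eq ?_) (setLIntegral_mono' measurableSet_Ioo hs)
    rw [setLIntegral_const, Real.volume_Ioo, sub_zero]
  refine le_trans (le_of_eq ?_) (mul_le_mul_right hlow _)
  rw [mul_right_comm (ENNReal.ofReal κ), ← ENNReal.ofReal_mul hκ0.le,
    ← mul_assoc (ENNReal.ofReal _) _ I, ← ENNReal.ofReal_mul (by positivity)]
  congr 2
  ring

end

/-! ### Couplings and the total variation distance -/

section TotalVariation

variable {α : Type*} [MeasurableSpace α]

/-- Two measures with the common part `ρ` are coupled by the diagonal coupling of `ρ` and the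
independent coupling of the remainders. -/
theorem tvDist_add_add_le (hD : MeasurableSet {q : α × α | q.1 ≠ q.2}) (ρ μ ν : Measure α)
    [SFinite ρ] [IsFiniteMeasure μ] [IsFiniteMeasure ν] (h : μ Set.univ = ν Set.univ) :
    tvDist (ρ + μ) (ρ + ν) ≤ μ Set.univ := by
  have hdiag : Measurable fun x : α => (x, x) := measurable_id.prodMk measurable_id
  have hp : μ Set.univ ≠ ⊤ := measure_ne_top _ _
  -- The independent coupling is normalized by the inverse mass, so zero mass is treated apart.
  by_cases h0 : μ Set.univ = 0
  · have hμ : μ = 0 := Measure.measure_univ_eq_zero.1 h0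
    have hν : ν = 0 := Measure.measure_univ_eq_zero.1 (h ▸ h0)
    subst hμ hν
    refine iInf₂_le_of_le (ρ.map fun x => (x, x)) ⟨?_, ?_⟩ ?_
    · rw [Measure.map_map measurable_fst hdiag, add_zero]
      exact Measure.map_id
    · rw [Measure.map_map measurable_snd hdiag, add_zero]
      exact Measure.map_id
    · rw [Measure.map_apply hdiag hD]
      simp
  · refine iInf₂_le_of_le ((ρ.map fun x => (x, x)) + (μ Set.univ)⁻¹ • μ.prod ν) ⟨?_, ?_⟩ ?_
    · rw [Measure.map_add _ _ measurable_fst, Measure.map_map measurable_fst hdiag,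
        Measure.map_smul, Measure.map_fst_prod, ← h, smul_smul, ENNReal.inv_mul_cancel h0 hp,
        one_smul]
      congr 1
      exact Measure.map_id
    · rw [Measure.map_add _ _ measurable_snd, Measure.map_map measurable_snd hdiag,
        Measure.map_smul, Measure.map_snd_prod, smul_smul, ENNReal.inv_mul_cancel h0 hp,
        one_smul]
      congr 1
      exact Measure.map_id
    · rw [Measure.add_apply, Measure.map_apply hdiag hD, Measure.smul_apply]
      simp only [ne_eq, not_true_eq_false, Set.preimage_ofPred_eq, Set.ofPred_false, measure_empty,
        zero_add, smul_eq_mul]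
      calc (μ Set.univ)⁻¹ * μ.prod ν {q | ¬q.1 = q.2}
          ≤ (μ Set.univ)⁻¹ * μ.prod ν (Set.univ ×ˢ Set.univ) := by
            gcongr
            simp
        _ = μ Set.univ := by
            rw [Measure.prod_prod, ← mul_assoc, ENNReal.inv_mul_cancel h0 hp, one_mul, h]

/-- The part of a coupling that sits on the diagonal is common to both marginals. -/
theorem exists_common_part (hD : MeasurableSet {q : α × α | q.1 ≠ q.2}) (π : Measure (α × α))
    [IsFiniteMeasure π] :
    ∃ ρ μ ν : Measure α, IsFiniteMeasure ρ ∧ IsFiniteMeasure μ ∧ IsFiniteMeasure ν ∧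
      π.map Prod.fst = ρ + μ ∧ π.map Prod.snd = ρ + ν ∧
      μ Set.univ = π {q | q.1 ≠ q.2} ∧ ν Set.univ = π {q | q.1 ≠ q.2} := by
  set D := {q : α × α | q.1 ≠ q.2}
  have hsplit : π = π.restrict Dᶜ + π.restrict D := by
    rw [add_comm, Measure.restrict_add_restrict_compl hD]
  have hcongr : (π.restrict Dᶜ).map Prod.snd = (π.restrict Dᶜ).map Prod.fst := by
    refine Measure.map_congr ?_
    filter_upwards [ae_restrict_mem hD.compl] with q hq
    exact (not_not.1 hq).symm
  refine ⟨(π.restrict Dᶜ).map Prod.fst, (π.restrict D).map Prod.fst, (π.restrict D).map Prod.snd,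
    inferInstance, inferInstance, inferInstance, ?_, ?_, ?_, ?_⟩
  · rw [← Measure.map_add _ _ measurable_fst, ← hsplit]
  · rw [← hcongr, ← Measure.map_add _ _ measurable_snd, ← hsplit]
  · simp [Measure.map_apply measurable_fst]
  · simp [Measure.map_apply measurable_snd]

/-- Doeblin's contraction: an additive, mass preserving map minorized by `δ η` contracts the total
variation distance by the factor `e^{-δ}`. -/
theorem tvDist_le_mul_tvDist (hD : MeasurableSet {q : α × α | q.1 ≠ q.2})
    {P : Measure α → Measure α}
    (hadd : ∀ μ ν : Measure α, IsFiniteMeasure μ → IsFiniteMeasure ν → P (μ + ν) = P μ + P ν)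
    (hmass : ∀ μ : Measure α, IsFiniteMeasure μ → P μ Set.univ = μ Set.univ)
    {η : Measure α} [IsProbabilityMeasure η] {δ : ℝ} (hδ : 0 ≤ δ)
    (hη : ∀ μ : Measure α, IsFiniteMeasure μ → (ENNReal.ofReal δ * μ Set.univ) • η ≤ P μ)
    (μ ν : Measure α) [IsProbabilityMeasure μ] :
    tvDist (P μ) (P ν) ≤ ENNReal.ofReal (Real.exp (-δ)) * tvDist μ ν := by
  have hfin : ∀ μ : Measure α, IsFiniteMeasure μ → IsFiniteMeasure (P μ) := fun μ h =>
    ⟨(hmass μ h).trans_lt (measure_lt_top μ _)⟩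
  conv_rhs => rw [tvDist]
  rw [ENNReal.mul_iInf_of_ne (by simpa using Real.exp_pos _) ENNReal.ofReal_ne_top]
  refine le_iInf fun π => ?_
  rw [ENNReal.mul_iInf_of_ne (by simpa using Real.exp_pos _) ENNReal.ofReal_ne_top]
  refine le_iInf fun hπ => ?_
  have hπf : IsFiniteMeasure π := by
    refine ⟨?_⟩
    have : π.map Prod.fst Set.univ = π Set.univ := by
      rw [Measure.map_apply measurable_fst MeasurableSet.univ, Set.preimage_univ]
    rw [← this, hπ.1]
    exact measure_lt_top _ _
  obtain ⟨ρ, μ', ν', hρ, hμ', hν', h1, h2, hm, hn⟩ := exists_common_part hD π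
  rw [← hπ.1, ← hπ.2, h1, h2, hadd _ _ hρ hμ', hadd _ _ hρ hν']
  set p := π {q | q.1 ≠ q.2}
  have hp : p ≠ ⊤ := measure_ne_top _ _
  have := hfin _ hρ
  have := hfin _ hμ'
  have := hfin _ hν'
  have hβ : ENNReal.ofReal δ * p ≠ ⊤ := ENNReal.mul_ne_top ENNReal.ofReal_ne_top hp
  -- The images of both off-diagonal parts dominate `κ`, which therefore joins the common part and
  -- reduces the mass left uncoupled.
  set κ : Measure α := (ENNReal.ofReal δ * p) • η
  have hκf : IsFiniteMeasure κ := η.smul_finite hβ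
  have hκμ : κ ≤ P μ' := by simpa only [κ, hm] using hη μ' hμ'
  have hκν : κ ≤ P ν' := by simpa only [κ, hn] using hη ν' hν'
  have hκu : κ Set.univ = ENNReal.ofReal δ * p := by simp [κ]
  have eμ : P ρ + P μ' = (P ρ + κ) + (P μ' - κ) := by
    rw [add_assoc, add_comm κ, Measure.sub_add_cancel_of_le hκμ]
  have eν : P ρ + P ν' = (P ρ + κ) + (P ν' - κ) := by
    rw [add_assoc, add_comm κ, Measure.sub_add_cancel_of_le hκν]
  have mμ : (P μ' - κ) Set.univ = p - ENNReal.ofReal δ * p := by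
    rw [Measure.sub_apply MeasurableSet.univ hκμ, hmass _ hμ', hm, hκu]
  have mν : (P ν' - κ) Set.univ = p - ENNReal.ofReal δ * p := by
    rw [Measure.sub_apply MeasurableSet.univ hκν, hmass _ hν', hn, hκu]
  rw [eμ, eν]
  refine (tvDist_add_add_le hD _ _ _ (mμ.trans mν.symm)).trans ?_
  -- The remaining mass is `p - δ p`, and `1 ≤ e^{-δ} + δ`.
  rw [mμ, tsub_le_iff_right, ← add_mul, ← ENNReal.ofReal_add (Real.exp_pos _).le hδ]
  refine le_mul_of_one_le_left' ?_
  rw [ENNReal.one_le_ofReal]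
  linarith [Real.add_one_le_exp (-δ)]

end TotalVariation

variable {U : Space d → ℝ} {r ε : ℝ}

theorem measurableSet_ne_state : MeasurableSet {q : State d × State d | q.1 ≠ q.2} :=
  (measurableSet_eq_fun measurable_fst measurable_snd).compl

/-! ### Contraction of the velocity jump process -/

section Contraction

variable [NeZero d] (hU : ContDiff ℝ 1 U) (hper : IsPeriodic U)

include hU hper

theorem law_add (hr : 0 < r) (hε : 0 < ε) {t : ℝ} (ht : 0 ≤ t) (μ ν : Measure (State d))
    [IsFiniteMeasure μ] [IsFiniteMeasure ν] :
    law U r ε (μ + ν) t = law U r ε μ t + law U r ε ν t := by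
  refine Measure.ext_of_lintegral _ fun f hf => ?_
  rw [lintegral_add_measure]
  simp_rw [lintegral_law hU hper hr hε hf ht]
  rw [lintegral_add_measure]

theorem law_univ (hr : 0 < r) (hε : 0 < ε) {t : ℝ} (ht : 0 ≤ t) (μ : Measure (State d))
    [IsFiniteMeasure μ] : law U r ε μ t Set.univ = μ Set.univ := by
  rw [← lintegral_one, lintegral_law hU hper hr hε measurable_const ht]
  simp_rw [semigroup_one hU hper hr hε ht]
  exact lintegral_one

theorem isProbabilityMeasure_law (hr : 0 < r) (hε : 0 < ε) {t : ℝ} (ht : 0 ≤ t)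
    (μ : Measure (State d)) [IsProbabilityMeasure μ] : IsProbabilityMeasure (law U r ε μ t) :=
  ⟨by rw [law_univ hU hper hr hε ht, measure_univ]⟩

theorem tvDist_law_le (hr : 0 < r) (hε : 0 < ε) {t δ : ℝ} (ht : 0 ≤ t) (hδ : 0 ≤ δ)
    (h : ∀ (f : State d → ℝ≥0∞), Measurable f → ∀ z,
      ENNReal.ofReal δ * ∫⁻ z, f z ∂(volume : Measure (Torus d)).prod (uniformSphere d) ≤
        semigroup U r ε t f z)
    (μ ν : Measure (State d)) [IsProbabilityMeasure μ] :
    tvDist (law U r ε μ t) (law U r ε ν t) ≤ ENNReal.ofReal (Real.exp (-δ)) * tvDist μ ν := by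
  have : IsProbabilityMeasure (volume : Measure (Torus d)) :=
    ⟨by rw [volume_pi, Measure.pi_univ]; simp⟩
  refine tvDist_le_mul_tvDist (P := fun μ => law U r ε μ t)
    (η := (volume : Measure (Torus d)).prod (uniformSphere d)) measurableSet_ne_state
    (fun μ ν _ _ => law_add hU hper hr hε ht μ ν) (fun μ _ => law_univ hU hper hr hε ht μ) hδ
    (fun μ _ => Measure.le_iff.2 fun s hs => ?_) μ ν
  have hf : Measurable (s.indicator (1 : State d → ℝ≥0∞)) := measurable_one.indicator hs
  have hl : law U r ε μ t s = ∫⁻ z, semigroup U r ε t (s.indicator 1) z ∂μ := by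
    rw [← lintegral_law hU hper hr hε hf ht, lintegral_indicator_one hs]
  have hz := fun z => h (s.indicator 1) hf z
  rw [lintegral_indicator_one hs] at hz
  calc ((ENNReal.ofReal δ * μ Set.univ) •
        (volume : Measure (Torus d)).prod (uniformSphere d)) s
      = ∫⁻ _, ENNReal.ofReal δ * (volume : Measure (Torus d)).prod (uniformSphere d) s ∂μ := by
        rw [lintegral_const, Measure.smul_apply, smul_eq_mul]
        ring
    _ ≤ law U r ε μ t s := hl ▸ lintegral_mono hz

theorem tvDist_law_gibbs_le_pow (hr : 0 < r) (hε : 0 < ε) {s t δ : ℝ} (hs : 0 ≤ s) (ht : 0 ≤ t)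
    (hδ : 0 ≤ δ)
    (h : ∀ (f : State d → ℝ≥0∞), Measurable f → ∀ z,
      ENNReal.ofReal δ * ∫⁻ z, f z ∂(volume : Measure (Torus d)).prod (uniformSphere d) ≤
        semigroup U r ε t f z) (n : ℕ) (μ : Measure (State d)) [IsProbabilityMeasure μ] :
    tvDist (law U r ε μ (s + n * t)) (gibbs U ε) ≤
      ENNReal.ofReal (Real.exp (-δ)) ^ n * tvDist μ (gibbs U ε) := by
  induction n with
  | zero =>
    -- Over the leftover time `s` the trivial minorization `δ = 0` gives nonexpansion.
    have h0 := tvDist_law_le hU hper hr hε hs le_rfl (fun f _ z => by simp) μ (gibbs U ε)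
    rw [law_gibbs hU hper hr hε hs] at h0
    simpa using h0
  | succ n ih =>
    have hn : 0 ≤ s + n * t := by positivity
    have := isProbabilityMeasure_law hU hper hr hε hn μ
    have h1 := tvDist_law_le hU hper hr hε ht hδ h (law U r ε μ (s + n * t)) (gibbs U ε)
    rw [law_gibbs hU hper hr hε ht, law_law hU hper hr hε hn ht] at h1
    have e : s + ((n + 1 : ℕ) : ℝ) * t = s + n * t + t := by push_cast; ring
    rw [e, pow_succ', mul_assoc]
    exact h1.trans (by gcongr)

end Contraction

end VelocityJump

end

/-! ### Choice of the constants -/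

theorem mainTheorem3 (d : ℕ) [NeZero d] (r : ℝ) (hr : 0 < r)
    (U : VelocityJump.Space d → ℝ) (hU : ContDiff ℝ ∞ U) (hper : VelocityJump.IsPeriodic U) :
    ∃ c θ : ℝ, 0 < c ∧ 0 < θ ∧
      ∀ ε : ℝ, 0 < ε →
        ∀ (μ : Measure (VelocityJump.State d)) [IsProbabilityMeasure μ] (t : ℝ), 0 ≤ t →
          VelocityJump.tvDist (VelocityJump.law U r ε μ t) (VelocityJump.gibbs U ε) ≤
            ENNReal.ofReal (Real.exp (-(c * Real.exp (-θ / ε)) * (t - Real.sqrt d))) *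
              VelocityJump.tvDist μ (VelocityJump.gibbs U ε) := by
  have hU1 : ContDiff ℝ 1 U := hU.of_le (by exact_mod_cast le_top)
  have hd : 0 < Real.sqrt d := Real.sqrt_pos.2 (Nat.cast_pos.2 (NeZero.pos d))
  obtain ⟨M, hM0, hM⟩ := VelocityJump.exists_norm_grad_le hU1
  obtain ⟨a, ha, hmin⟩ := VelocityJump.exists_minorization hU1 hper hM hr
  -- Each window contributes `δ = a e^{-r√d} e^{-M√d/ε}`; dividing by its length `√d` gives the rate
  -- `c e^{-θ/ε}`.
  refine ⟨a * Real.exp (-(r * Real.sqrt d)) / Real.sqrt d, M * Real.sqrt d, by positivity,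
    by positivity, fun ε hε μ _ t ht => ?_⟩
  have hδ : 0 ≤ a * Real.exp (-((M / ε + r) * Real.sqrt d)) := by positivity
  set n := ⌊t / Real.sqrt d⌋₊
  have hn : (n : ℝ) * Real.sqrt d ≤ t := (le_div_iff₀ hd).1 (Nat.floor_le (by positivity))
  have hn' : t - Real.sqrt d ≤ n * Real.sqrt d := by
    have h1 := (div_lt_iff₀ hd).1 (Nat.lt_floor_add_one (t / Real.sqrt d))
    rw [add_mul, one_mul] at h1
    exact sub_le_iff_le_add.2 h1.le
  -- The leftover time `t - n √d` comes first, followed by the `n` complete windows.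
  have key := VelocityJump.tvDist_law_gibbs_le_pow hU1 hper hr hε (sub_nonneg.2 hn) hd.le hδ
    (hmin ε hε) n μ
  rw [sub_add_cancel] at key
  refine key.trans ?_
  gcongr
  rw [← ENNReal.ofReal_pow (Real.exp_pos _).le, ← Real.exp_nat_mul]
  refine ENNReal.ofReal_le_ofReal (Real.exp_le_exp.2 ?_)
  have hexp : Real.exp (-((M / ε + r) * Real.sqrt d)) =
      Real.exp (-(r * Real.sqrt d)) * Real.exp (-(M * Real.sqrt d) / ε) := by
    rw [← Real.exp_add]
    congr 1
    field_simp
    ring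
  set b := a * Real.exp (-(r * Real.sqrt d)) / Real.sqrt d * Real.exp (-(M * Real.sqrt d) / ε)
    with hb
  have hb0 : 0 ≤ b := by positivity
  have hab : a * Real.exp (-((M / ε + r) * Real.sqrt d)) = b * Real.sqrt d := by
    rw [hexp, hb]
    field_simp
  rw [hab]
  nlinarith [mul_le_mul_of_nonneg_left hn' hb0]
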